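/- **Setting.** Let $\Sigma$ be a connected closed Riemann surface with complex structure $j$ and a Riemannian metric $h$ in the conformal class of $j$, with a fixed spin structure: a principal $\mathrm{Spin}(2)=S^1$-bundle $\mathrm{Spin}(\Sigma)$ with an equivariant double covering of the bundle of oriented orthonormal frames (i.e. of unit tangent vectors). For $d\in\mathbb Z\setminus\{0\}$ let $L_d=\mathrm{Spin}(\Sigma)\times_{\mu_d}\mathbb C$, $\mu_d(s)v=s^dv$. Then $L_2=T\Sigma$ and $L_d=(L_1)^d$; $L_1$ carries the holomorphic structure for which $(L_1)^2=T\Sigma$ holomorphically, and $L_d=(L_1)^d$ carries the induced one, with Dolbeault operator $\bar\partial$. Let $X$ be a (Hausdorff, finite-dimensional, boundaryless) smooth manifold with a smooth almost complex structure $J$ (for instance a compact symplectic manifold with a tame $J$) and a smooth connection $A$ on $TX$, let $\nabla^{A,J}=\nabla^A-\tfrac12J(\nabla^AJ)$, and denote by the same symbol its pullback to $\varphi^*TX$ for a smooth map $\varphi:\Sigma\to X$. Put $\bar\partial_J\varphi=\tfrac12(d\varphi+J\circ d\varphi\circ j)$. For a smooth section $\psi$ of $L_d\otimes_J\varphi^*TX$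 define locally $$\mathcal D^{A,J}_\varphi\psi=\theta\otimes(\nabla^{A,J}\psi_\theta)^{0,1}+\bar\partial\theta\otimes\psi_\theta ,$$ where $\theta$ is a nonvanishing smooth local section of $L_d$, $\psi=\theta\otimes\psi_\theta$ with $\psi_\theta$ a local section of $\varphi^*TX$, and $\alpha^{0,1}=\tfrac12(\alpha+J\circ\alpha\circ j)$; this does not depend on $\theta$. The pair $(\varphi,\psi)$ is an $(A,J)$-holomorphic supercurve $(\Sigma,L_d)\to X$ if $\bar\partial_J\varphi=0$ and $\mathcal D^{A,J}_\varphi\psi=0$. **Statement.** Let $m:\Sigma\to\Sigma$ be a conformal automorphism (a diffeomorphism with $m^*h=\lambda_m h$, $\lambda_m>0$) which is homotopic to the identity, and let $\Phi_m=\sqrt{dm}^{\,d}:L_d\to L_d$ be a lift of its differential, i.e. the $d$-th power of a continuous complex linear bundle isomorphism $\sqrt{dm}:L_1\to L_1$ covering $m$ whose square is $dm:T\Sigma\to T\Sigma$. Let $\varphi\in C^\infty(\Sigma,X)$, let $\psi$ be a smooth section of $L_d\otimes_J\varphi^*TX$, and put $$\tilde\varphi=\varphi\circ m,\qquad \tilde\psi=\Phi_m^{-1}\circ\psi\circ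 m .$$ Then $\tilde\psi$ is a smooth section of $L_d\otimes_J\tilde\varphi^*TX$, and $$\mathcal D^{A,J}_{\tilde\varphi}\tilde\psi=\Phi_m^{-1}\circ\big(\mathcal D^{A,J}_\varphi\psi\big)\circ dm\ \in\ \Omega^{0,1}(L_d\otimes_J\tilde\varphi^*TX),$$ that is, $(\mathcal D^{A,J}_{\tilde\varphi}\tilde\psi)_z(v)=\Phi_m^{-1}\big((\mathcal D^{A,J}_\varphi\psi)_{m(z)}(d_zm\,v)\big)$ for all $z\in\Sigma$, $v\in T_z\Sigma$, and this is a smooth $(0,1)$-form. In particular the equations defining $(A,J)$-holomorphic supercurves are conformally invariant: $$\bar\partial_J\varphi=0\iff\bar\partial_J\tilde\varphi=0,\qquad \mathcal D^{A,J}_\varphi\psi=0\iff\mathcal D^{A,J}_{\tilde\varphi}\tilde\psi=0 .$$ -/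

import Mathlib

open scoped Manifold ContDiff Topology TensorProduct Bundle

noncomputable section

namespace Supercurve

/-! ### Riemann surfaces

A Riemann surface is a charted space over `ℂ` with holomorphic transition maps. Its real tangent
spaces `TangentSpace 𝓘(ℝ, ℂ) z` carry the complex structure `j`, multiplication by `i` in any
holomorphic chart (Mathlib's tangent space at `z` is `ℂ` via the preferred chart at `z`). -/

section Surface

variable {M : Type*} [TopologicalSpace M] [ChartedSpace ℂ M]

/-- A complex one-dimensional manifold is a smooth real manifold. -/
instance instRealOfComplex [IsManifold 𝓘(ℂ, ℂ) ω M] : IsManifold 𝓘(ℝ, ℂ) ∞ M := by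
  apply isManifold_of_contDiffOn
  intro e e' he he'
  have h := (contDiffGroupoid ω 𝓘(ℂ, ℂ)).compatible he he'
  rw [contDiffGroupoid, mem_groupoid_of_pregroupoid] at h
  have h1 := h.1
  simp only [contDiffPregroupoid, modelWithCornersSelf_coe, modelWithCornersSelf_coe_symm,
    Function.comp_id, Function.id_comp, Set.preimage_id, Set.range_id, Set.inter_univ] at h1 ⊢
  exact (h1.restrict_scalars ℝ).of_le le_top

/-- The complex structure of the real tangent space of a Riemann surface: multiplication by the
complex number `c`; the almost complex structure `j` is `cmul Complex.I`. -/
def cmul {z : M} (c : ℂ) : TangentSpace 𝓘(ℝ, ℂ) z →L[ℝ] TangentSpace 𝓘(ℝ, ℂ) z :=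
  (ContinuousLinearMap.mul ℝ ℂ c : ℂ →L[ℝ] ℂ)

theorem triv_eq [IsManifold 𝓘(ℂ, ℂ) ω M] {x z : M} (hz : z ∈ (chartAt ℂ x).source) (v : ℂ) :
    (trivializationAt ℂ (TangentSpace 𝓘(ℝ, ℂ) : M → Type _) x ⟨z, v⟩).2 =
      (trivializationAt ℂ (TangentSpace 𝓘(ℂ, ℂ) : M → Type _) x ⟨z, v⟩).2 := by
  rw [TangentBundle.trivializationAt_apply, TangentBundle.trivializationAt_apply]
  have hd : DifferentiableAt ℂ ((chartAt ℂ x) ∘ (chartAt ℂ z).symm) (chartAt ℂ z z) := by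
    have h := (contDiffGroupoid ω 𝓘(ℂ, ℂ)).compatible (chart_mem_atlas ℂ z) (chart_mem_atlas ℂ x)
    rw [contDiffGroupoid, mem_groupoid_of_pregroupoid] at h
    have h1 := h.1
    simp only [contDiffPregroupoid, modelWithCornersSelf_coe, modelWithCornersSelf_coe_symm,
      Function.comp_id, Function.id_comp, Set.preimage_id, Set.range_id, Set.inter_univ] at h1
    refine (h1.contDiffAt (((chartAt ℂ z).symm.trans (chartAt ℂ x)).open_source.mem_nhds ?_)
      ).differentiableAt (by simp)
    simp [hz]
  simp only [mfld_simps, fderivWithin_univ]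
  rw [hd.fderiv_restrictScalars ℝ]
  rfl

theorem triv_cmul [IsManifold 𝓘(ℂ, ℂ) ω M] {x z : M} (hz : z ∈ (chartAt ℂ x).source) (c : ℂ)
    (v : TangentSpace 𝓘(ℝ, ℂ) z) :
    (trivializationAt ℂ (TangentSpace 𝓘(ℝ, ℂ) : M → Type _) x ⟨z, cmul c v⟩).2 =
      c * (trivializationAt ℂ (TangentSpace 𝓘(ℝ, ℂ) : M → Type _) x ⟨z, v⟩).2 := by
  refine (triv_eq hz _).trans (Eq.trans ?_ (congrArg (c * ·) (triv_eq hz _).symm))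
  rw [TangentBundle.trivializationAt_apply, TangentBundle.trivializationAt_apply]
  exact (fderivWithin ℂ ((chartAt ℂ x).extend 𝓘(ℂ, ℂ) ∘
    ((chartAt ℂ z).extend 𝓘(ℂ, ℂ)).symm) (Set.range 𝓘(ℂ, ℂ))
      ((chartAt ℂ z).extend 𝓘(ℂ, ℂ) z)).map_smul c (show ℂ from v)

/-- A vector field on a Riemann surface, holomorphic on the set `U`. -/
def IsHolVectorField (V : ∀ z : M, TangentSpace 𝓘(ℝ, ℂ) z) [IsManifold 𝓘(ℂ, ℂ) ω M]
    (U : Set M) : Prop :=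
  MDifferentiableOn 𝓘(ℂ, ℂ) 𝓘(ℂ, ℂ).tangent
    (fun z => (⟨z, V z⟩ : TangentBundle 𝓘(ℂ, ℂ) M)) U

/-- The Cauchy-Riemann operator on complex valued functions: the `(0,1)`-part
`½ (df + i df ∘ j)` of the differential, evaluated at the tangent vector `v`. -/
def dbarFun (f : M → ℂ) (z : M) (v : TangentSpace 𝓘(ℝ, ℂ) z) : ℂ :=
  (1 / 2 : ℂ) * (mvfderiv 𝓘(ℝ, ℂ) f z v + Complex.I * mvfderiv 𝓘(ℝ, ℂ) f z (cmul Complex.I v))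

end Surface

/-! ### Metrics, spin structures and the line bundles `L_d` -/

section Spin

variable {M : Type*} [TopologicalSpace M] [ChartedSpace ℂ M] [IsManifold 𝓘(ℂ, ℂ) ω M]

/-- Smooth Riemannian metrics on the real surface underlying a Riemann surface. -/
abbrev SurfaceMetric (M : Type*) [TopologicalSpace M] [ChartedSpace ℂ M]
    [IsManifold 𝓘(ℂ, ℂ) ω M] :=
  Bundle.ContMDiffRiemannianMetric 𝓘(ℝ, ℂ) ∞ ℂ (fun z : M => TangentSpace 𝓘(ℝ, ℂ) z)

/-- The metric `h` lies in the conformal class determined by the complex structure `j`,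
i.e. `j` is `h`-orthogonal. -/
def InConformalClass (h : SurfaceMetric M) : Prop :=
  ∀ (z : M) (v w : TangentSpace 𝓘(ℝ, ℂ) z),
    h.inner z (cmul Complex.I v) (cmul Complex.I w) = h.inner z v w

/-- A conformal automorphism: a diffeomorphism `m` with `m^* h = lam • h`, `lam > 0`. -/
def IsConformalAut (h : SurfaceMetric M) (m : M ≃ₘ^∞⟮𝓘(ℝ, ℂ), 𝓘(ℝ, ℂ)⟯ M) : Prop :=
  ∃ lam : M → ℝ, (∀ z, 0 < lam z) ∧ ∀ (z : M) (v w : TangentSpace 𝓘(ℝ, ℂ) z),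
    h.inner (m z) (mfderiv 𝓘(ℝ, ℂ) 𝓘(ℝ, ℂ) m z v) (mfderiv 𝓘(ℝ, ℂ) 𝓘(ℝ, ℂ) m z w)
      = lam z * h.inner z v w

/-- A spin structure on `(M, h)`: a principal bundle `P` for `Spin(2) = S¹`, with a continuous map
`frame` from `P` to the bundle of `h`-unit tangent vectors (the oriented orthonormal frames) which
covers the identity of `M` and is equivariant for the double covering `s ↦ s²` of `SO(2) = S¹`. -/
structure SpinStructure (h : SurfaceMetric M) (P : Type*) [TopologicalSpace P]
    [MulAction Circle P] where
  /-- the double covering of the bundle of unit tangent vectors -/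
  frame : P → TangentBundle 𝓘(ℝ, ℂ) M
  continuous_frame : Continuous frame
  frame_unit : ∀ p, h.inner (frame p).proj (frame p).2 (frame p).2 = 1
  frame_smul : ∀ (s : Circle) (p : P),
    frame (s • p) = ⟨(frame p).proj, cmul ((s : ℂ) ^ 2) (frame p).2⟩
  /-- `P` is a locally trivial principal bundle -/
  exists_trivialization : ∀ z : M, ∃ t : Bundle.Trivialization Circle (fun p => (frame p).proj),
    z ∈ t.baseSet ∧ ∀ (s : Circle) (p : P), (frame p).proj ∈ t.baseSet →
      (t (s • p)).2 = s * (t p).2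

namespace SpinStructure

variable {h : SurfaceMetric M} {P : Type*} [TopologicalSpace P] [MulAction Circle P]
  (S : SpinStructure h P)

/-- The bundle projection of the spin bundle. -/
def proj (p : P) : M := (S.frame p).proj

/-- The fibre of the spin bundle over `z`. -/
abbrev Fib (z : M) : Type _ := {p : P // S.proj p = z}

theorem nonempty_fib (z : M) : Nonempty (S.Fib z) := by
  obtain ⟨t, hz, -⟩ := S.exists_trivialization z
  exact ⟨⟨t.toOpenPartialHomeomorph.symm (z, 1), t.proj_symm_apply' hz⟩⟩

/-- An arbitrary point of the fibre over `z`. -/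
def point (z : M) : S.Fib z := (S.nonempty_fib z).some

/-- The fibre over `z` of the associated complex line bundle `L_d = P ×_{μ_d} ℂ`, where
`μ_d s v = s ^ d * v`. The class `[p, v]` of `(p, v)`, where `[s • p, v] = [p, s ^ d * v]`, is
encoded as the function `a` on the fibre of `P` with `[p, v] = [q, a q]` for all `q`, so that
`a (s • q) = s ^ (-d) * a q`. -/
def L (d : ℤ) (z : M) : Submodule ℂ (S.Fib z → ℂ) where
  carrier := {a | ∀ (s : Circle) (p q : S.Fib z), (q : P) = s • (p : P) →
    a q = (s : ℂ) ^ (-d) * a p}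
  add_mem' := by
    intro a b ha hb s p q hq
    simp only [Pi.add_apply, ha s p q hq, hb s p q hq]; ring
  zero_mem' := by intro s p q _; simp
  smul_mem' := by
    intro c a ha s p q hq
    simp only [Pi.smul_apply, smul_eq_mul, ha s p q hq]; ring

/-- The coefficient of a section of `L_d`, as a function on the total space of the spin bundle:
`a z = [p, S.coord a p]` for every point `p` over `z`. -/
def coord {d : ℤ} (a : ∀ z, S.L d z) (p : P) : ℂ := (a (S.proj p)).1 ⟨p, rfl⟩

/-- Continuity of a section of `L_d` on the set `U`. -/
def IsContSection {d : ℤ} (a : ∀ z, S.L d z) (U : Set M) : Prop :=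
  ContinuousOn (S.coord a) (S.proj ⁻¹' U)

/-- The quotient `a / b` of two elements of a fibre of `L_d`, for `b ≠ 0` (and `0` for `b = 0`):
the complex number `c` with `a = c • b`; as a linear function of `a`. -/
def ratio {d : ℤ} {z : M} (b : S.L d z) : S.L d z →ₗ[ℂ] ℂ where
  toFun a := a.1 (S.point z) / b.1 (S.point z)
  map_add' a a' := by simp [add_div]
  map_smul' c a := by simp [mul_div_assoc]

/-- The tangent vector at `z` belonging to a point of the fibre of the spin bundle over `z`. -/
def frameVec {z : M} (p : S.Fib z) : TangentSpace 𝓘(ℝ, ℂ) z := p.2 ▸ (S.frame p).2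

/-- The canonical identification `L_1 ⊗ L_1 = L_2 = TM`: the square `[p, v ^ 2]` of
`[p, v]`, identified with the tangent vector `v ^ 2 • frame p`. -/
def sq {z : M} (a : S.L 1 z) : TangentSpace 𝓘(ℝ, ℂ) z :=
  cmul (a.1 (S.point z) ^ 2) (S.frameVec (S.point z))

/-- The canonical map `l_d : L_1 → (L_1)^d = L_d`, `[p, v] ↦ [p, v ^ d]`
(meaningful on nonzero elements when `d` is negative). -/
def pow (d : ℤ) {z : M} (a : S.L 1 z) : S.L d z :=
  ⟨fun p => a.1 p ^ d, by
    intro s p q hq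
    have h1 := a.2 s p q hq
    change a.1 q ^ d = (s : ℂ) ^ (-d) * a.1 p ^ d
    rw [h1, mul_zpow, ← zpow_mul]
    simp⟩

/-- A nonvanishing holomorphic section of `L_1` on the open set `U`: a continuous section
whose square is a nonvanishing holomorphic vector field. -/
def IsHolRoot (a : ∀ z, S.L 1 z) (U : Set M) : Prop :=
  IsOpen U ∧ S.IsContSection a U ∧ (∀ z ∈ U, a z ≠ 0) ∧
    IsHolVectorField (fun z => S.sq (a z)) U

/-- The local holomorphic frames defining the holomorphic structure of `L_d = (L_1)^d` that is
induced by the spin structure: the `d`-th powers of the local holomorphic frames of `L_1`. -/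
def IsHolFrame {d : ℤ} (e : ∀ z, S.L d z) (U : Set M) : Prop :=
  ∃ a : ∀ z, S.L 1 z, S.IsHolRoot a U ∧ ∀ z ∈ U, e z = S.pow d (a z)

/-- Smoothness of a section `θ` of `L_d` on the set `U`: near every point of `U` it is a smooth
multiple of a local holomorphic frame. -/
def IsSmoothSection {d : ℤ} (θ : ∀ z, S.L d z) (U : Set M) : Prop :=
  ∀ z ∈ U, ∃ (e : ∀ z, S.L d z) (W : Set M), z ∈ W ∧ S.IsHolFrame e W ∧
    ContMDiffOn 𝓘(ℝ, ℂ) 𝓘(ℝ, ℂ) ∞ (fun z' => S.ratio (e z') (θ z')) (U ∩ W)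

/-- A nonvanishing smooth section `θ` of `L_d` on the open set `U`. -/
def IsSmoothFrame {d : ℤ} (θ : ∀ z, S.L d z) (U : Set M) : Prop :=
  IsOpen U ∧ S.IsSmoothSection θ U ∧ ∀ z ∈ U, θ z ≠ 0

theorem exists_smul_eq {z : M} (p q : S.Fib z) : ∃ s : Circle, (q : P) = s • (p : P) := by
  obtain ⟨t, hz, ht⟩ := S.exists_trivialization z
  have hp : S.proj p = z := p.2
  have hq : S.proj q = z := q.2
  refine ⟨(t q).2 * (t p).2⁻¹, ?_⟩
  have hps : S.proj (((t q).2 * (t p).2⁻¹) • (p : P)) = z := by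
    unfold proj at hp ⊢
    rw [S.frame_smul]
    exact hp
  have h1 : (q : P) ∈ t.source := by
    rw [t.mem_source]; unfold proj at hq; rw [hq]; exact hz
  have h2 : ((t q).2 * (t p).2⁻¹) • (p : P) ∈ t.source := by
    rw [t.mem_source]; unfold proj at hps; rw [hps]; exact hz
  have h3 : t q = t (((t q).2 * (t p).2⁻¹) • (p : P)) := by
    refine Prod.ext ?_ ?_
    · rw [t.coe_fst h1, t.coe_fst h2]
      exact hq.trans hps.symm
    · rw [ht _ _ (by unfold proj at hp; rw [hp]; exact hz)]
      simp
  exact t.injOn h1 h2 h3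

theorem exists_holRoot (z₀ : M) :
    ∃ a : ∀ z, S.L 1 z, ∃ U : Set M, z₀ ∈ U ∧ S.IsHolRoot a U := by
  classical
  obtain ⟨t, hz₀, ht⟩ := S.exists_trivialization z₀
  -- the tangent vectors `frame p` in the coordinates near `z₀`
  let τ := trivializationAt ℂ (TangentSpace 𝓘(ℝ, ℂ) : M → Type _) z₀
  let w : P → ℂ := fun p => (τ (S.frame p)).2
  let σ : M → P := fun z => t.toOpenPartialHomeomorph.symm (z, 1)
  let B : Set M := t.baseSet ∩ (chartAt ℂ z₀).source
  have hBopen : IsOpen B := t.open_baseSet.inter (chartAt ℂ z₀).open_source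
  have hσp : ∀ z ∈ t.baseSet, S.proj (σ z) = z := fun z hz => t.proj_symm_apply' hz
  have hσc : ContinuousOn σ t.baseSet := t.continuousOn_symm_prodMk_left
  have hframe : ∀ p, S.frame p = ⟨S.proj p, (S.frame p).2⟩ := fun p => rfl
  have hsmul : ∀ (s : Circle) (p : P), S.proj p ∈ (chartAt ℂ z₀).source →
      w (s • p) = (s : ℂ) ^ 2 * w p := by
    intro s p hp
    change (τ (S.frame (s • p))).2 = _
    rw [S.frame_smul]
    exact triv_cmul hp _ _
  have hτsrc : ∀ p, S.proj p ∈ (chartAt ℂ z₀).source → S.frame p ∈ τ.source := by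
    intro p hp
    rw [τ.mem_source]
    exact hp
  have hwne : ∀ p, S.proj p ∈ (chartAt ℂ z₀).source → w p ≠ 0 := by
    intro p hp h0
    have h1 : (S.frame p).2 = 0 := by
      have h2 := triv_cmul (x := z₀) (z := S.proj p) hp 0 (S.frame p).2
      have h3 : τ ⟨S.proj p, (S.frame p).2⟩ = τ ⟨S.proj p, cmul 0 (S.frame p).2⟩ := by
        refine Prod.ext rfl ?_
        rw [h2, zero_mul]
        exact h0
      have h4 : (⟨S.proj p, (S.frame p).2⟩ : TangentBundle 𝓘(ℝ, ℂ) M) =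
          ⟨S.proj p, cmul 0 (S.frame p).2⟩ :=
        τ.injOn (τ.mem_source.2 hp) (τ.mem_source.2 hp) h3
      have h5 : (S.frame p).2 = cmul 0 (S.frame p).2 := eq_of_heq (Bundle.TotalSpace.mk.inj h4).2
      rw [h5]
      exact zero_mul (M₀ := ℂ) _
    have h2 := S.frame_unit p
    rw [h1] at h2
    simp at h2
  let u : M → ℂ := fun z => w (σ z)
  have huc : ContinuousOn u B := by
    have h1 : ContinuousOn (fun z => τ (S.frame (σ z))) B := by
      refine τ.continuousOn.comp (S.continuous_frame.comp_continuousOn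
        (hσc.mono Set.inter_subset_left)) ?_
      intro z hz
      apply hτsrc
      rw [hσp z hz.1]
      exact hz.2
    exact continuous_snd.comp_continuousOn h1
  have hz₀B : z₀ ∈ B := ⟨hz₀, mem_chart_source ℂ z₀⟩
  have hune : ∀ z ∈ B, u z ≠ 0 := fun z hz => hwne _ (by rw [hσp z hz.1]; exact hz.2)
  let U : Set M := B ∩ (fun z => u z / u z₀) ⁻¹' Complex.slitPlane
  have hUopen : IsOpen U :=
    (huc.div_const _).isOpen_inter_preimage hBopen Complex.isOpen_slitPlane
  have hz₀U : z₀ ∈ U := by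
    refine ⟨hz₀B, ?_⟩
    simp [div_self (hune z₀ hz₀B)]
  let c₀ : ℂ := (u z₀)⁻¹ ^ (1 / 2 : ℂ)
  let ρ : M → ℂ := fun z => c₀ * (u z / u z₀) ^ (-1 / 2 : ℂ)
  have hsq : ∀ x : ℂ, ∀ r : ℂ, (x ^ r) ^ 2 = x ^ (2 * r) := by
    intro x r
    rw [← Complex.cpow_nat_mul]; norm_num
  have hρsq : ∀ z ∈ B, ρ z ^ 2 * u z = 1 := by
    intro z hz
    have h0 := hune z₀ hz₀B
    have h1 := hune z hz
    change (c₀ * (u z / u z₀) ^ (-1 / 2 : ℂ)) ^ 2 * u z = 1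
    rw [mul_pow, hsq, hsq]
    have e1 : (2 * (1 / 2) : ℂ) = 1 := by norm_num
    have e2 : (2 * (-1 / 2) : ℂ) = -1 := by norm_num
    rw [e1, e2, Complex.cpow_one, Complex.cpow_neg_one]
    field_simp
  have hρc : ContinuousOn ρ U := by
    refine continuousOn_const.mul ?_
    refine ContinuousOn.cpow ((huc.div_const _).mono Set.inter_subset_left)
      continuousOn_const ?_
    intro z hz
    exact hz.2
  -- the square root, as a function on `P`
  let g : P → ℂ := fun p => ((t p).2 : ℂ)
  have hgne : ∀ p, g p ≠ 0 := fun p => Circle.coe_ne_zero _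
  have hpσ : ∀ p, S.proj p ∈ t.baseSet → p = (t p).2 • σ (S.proj p) := by
    intro p hp
    have hσ := hσp _ hp
    have hps : S.proj ((t p).2 • σ (S.proj p)) = S.proj p := by
      unfold proj at hσ ⊢
      rw [S.frame_smul]
      exact hσ
    have hs1 : p ∈ t.source := by rw [t.mem_source]; exact hp
    have hs2 : (t p).2 • σ (S.proj p) ∈ t.source := by
      rw [t.mem_source]
      change S.proj _ ∈ _
      rw [hps]; exact hp
    have h3 : t p = t ((t p).2 • σ (S.proj p)) := by
      refine Prod.ext ?_ ?_
      rotate_left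
      · rw [ht _ _ (by change S.proj _ ∈ _; rw [hσ]; exact hp)]
        change _ = _ * (t (t.toOpenPartialHomeomorph.symm (S.proj p, 1))).2
        rw [t.apply_symm_apply' hp]
        simp
      rw [t.coe_fst hs1, t.coe_fst hs2]; exact hps.symm
    exact t.injOn hs1 hs2 h3
  have hw : ∀ p, S.proj p ∈ B → w p = g p ^ 2 * u (S.proj p) := by
    intro p hp
    have h1 := hsmul (t p).2 (σ (S.proj p)) (by rw [hσp _ hp.1]; exact hp.2)
    rw [← hpσ p hp.1] at h1
    exact h1
  let a : ∀ z, S.L 1 z := fun z =>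
    if hz : z ∈ t.baseSet then
      ⟨fun p => (g p)⁻¹ * ρ z, by
        intro s p q hq
        have h1 : (t q).2 = s * (t p).2 := by
          rw [hq]
          exact ht s p (by have := p.2; unfold proj at this; rw [this]; exact hz)
        change (g q)⁻¹ * ρ z = (s : ℂ) ^ (-1 : ℤ) * ((g p)⁻¹ * ρ z)
        have h2 : g q = s * g p := by
          change ((t q).2 : ℂ) = _
          rw [h1, Circle.coe_mul]
        rw [h2, mul_inv, zpow_neg_one]
        ring⟩
    else 0
  have ha : ∀ z ∈ t.baseSet, ∀ p : S.Fib z, (a z).1 p = (g p)⁻¹ * ρ z := by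
    intro z hz p
    simp only [a, dif_pos hz]
  have hρne : ∀ z ∈ B, ρ z ≠ 0 := by
    intro z hz h0
    have h1 := hρsq z hz
    rw [h0] at h1
    simp at h1
  refine ⟨a, U, hz₀U, hUopen, ?_, ?_, ?_⟩
  · have h1 : ContinuousOn (fun p => (g p)⁻¹ * ρ (S.proj p)) (S.proj ⁻¹' U) := by
      have hgc : ContinuousOn g (S.proj ⁻¹' U) := by
        have h2 : ContinuousOn (fun p => (t p).2) (S.proj ⁻¹' U) :=
          continuous_snd.comp_continuousOn
            (t.toOpenPartialHomeomorph.continuousOn.mono fun p hp => t.mem_source.2 hp.1.1)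
        exact continuous_subtype_val.comp_continuousOn h2
      have hpc : Continuous S.proj :=
        (FiberBundle.continuous_proj ℂ (TangentSpace 𝓘(ℝ, ℂ) : M → Type _)).comp
          S.continuous_frame
      exact (hgc.inv₀ fun p _ => hgne p).mul
        (hρc.comp hpc.continuousOn fun p hp => hp)
    refine h1.congr ?_
    intro p hp
    exact ha _ hp.1.1 _
  · intro z hz h0
    have h1 := ha z hz.1.1 (S.point z)
    rw [h0] at h1
    exact mul_ne_zero (inv_ne_zero (hgne _)) (hρne z hz.1) h1.symm
  · -- in the coordinates near `z₀` the square is the coordinate vector field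
    have key : ∀ z ∈ U, (τ ⟨z, S.sq (a z)⟩).2 = 1 := by
      intro z hz
      unfold sq
      generalize S.point z = p
      rw [ha z hz.1.1 p]
      obtain ⟨p, rfl⟩ := p
      have h1 := triv_cmul (x := z₀) (z := S.proj p) hz.1.2 (((g p)⁻¹ * ρ (S.proj p)) ^ 2)
        (S.frame p).2
      refine h1.trans ?_
      have h2 : (τ ⟨S.proj p, (S.frame p).2⟩).2 = g p ^ 2 * u (S.proj p) := hw p hz.1
      rw [h2, mul_pow, inv_pow]
      have h3 := hρsq _ hz.1
      have h4 := hgne p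
      field_simp
      exact h3
    have hB2 : U ⊆ (chartAt ℂ z₀).source := fun z hz => hz.1.2
    let τc := trivializationAt ℂ (TangentSpace 𝓘(ℂ, ℂ) : M → Type _) z₀
    have hc : MDifferentiableOn 𝓘(ℂ, ℂ) 𝓘(ℂ, ℂ).tangent
        (fun z => τc.toOpenPartialHomeomorph.symm (z, (1 : ℂ))) U := by
      have h1 := (τc.contMDiffOn_symm (n := 1) (IB := 𝓘(ℂ, ℂ))).mdifferentiableOn one_ne_zero
      have h2 : MDifferentiableOn 𝓘(ℂ, ℂ) (𝓘(ℂ, ℂ).prod 𝓘(ℂ, ℂ))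
          (fun z : M => (z, (1 : ℂ))) U :=
        (mdifferentiable_id.prodMk mdifferentiable_const).mdifferentiableOn
      refine h1.comp h2 ?_
      intro z hz
      rw [Set.mem_preimage, τc.mem_target]
      exact hB2 hz
    refine hc.congr ?_
    intro z hz
    have hs : (⟨z, S.sq (a z)⟩ : TangentBundle 𝓘(ℂ, ℂ) M) ∈ τc.source := by
      rw [τc.mem_source]; exact hB2 hz
    have h3 : τc ⟨z, S.sq (a z)⟩ = (z, 1) := by
      refine Prod.ext rfl ?_
      rw [← key z hz]
      exact (triv_eq (hB2 hz) _).symm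
    rw [← h3]
    exact (τc.left_inv hs).symm

theorem coord_eq_zero_iff {d : ℤ} {z : M} (a : S.L d z) (p : S.Fib z) : a.1 p = 0 ↔ a = 0 := by
  constructor
  · intro h0
    ext q
    obtain ⟨t, hz, ht⟩ := S.exists_trivialization z
    obtain ⟨s, hs⟩ := S.exists_smul_eq p q
    rw [a.2 s p q hs, h0]
    simp
  · rintro rfl
    rfl

theorem exists_holFrame (d : ℤ) (z : M) :
    ∃ e : ∀ z, S.L d z, ∃ U : Set M, z ∈ U ∧ S.IsHolFrame e U := by
  obtain ⟨a, U, hz, ha⟩ := S.exists_holRoot z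
  exact ⟨fun z' => S.pow d (a z'), U, hz, a, ha, fun _ _ => rfl⟩

/-- A local holomorphic frame of `L_d` near the point `z`. -/
def holFrameAt (d : ℤ) (z : M) : ∀ z, S.L d z := (S.exists_holFrame d z).choose

theorem exists_smoothFrame (d : ℤ) (z : M) :
    ∃ θ : ∀ z, S.L d z, ∃ U : Set M, z ∈ U ∧ S.IsSmoothFrame θ U := by
  obtain ⟨e, U, hz, he⟩ := S.exists_holFrame d z
  have hne : ∀ z ∈ U, ∀ p, (e z).1 p ≠ 0 := by
    obtain ⟨a, ha, hea⟩ := he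
    intro z' hz' p
    rw [hea z' hz']
    exact zpow_ne_zero d (fun h0 => ha.2.2.1 z' hz' ((S.coord_eq_zero_iff _ p).1 h0))
  obtain ⟨a, ha, hea⟩ := id he
  refine ⟨e, U, hz, ha.1, ?_, ?_⟩
  · intro z' hz'
    refine ⟨e, U, hz', he, ?_⟩
    refine (contMDiffOn_const (c := (1 : ℂ))).congr ?_
    intro y hy
    exact div_self (hne y hy.1 _)
  · intro z' hz' h0
    exact hne z' hz' (S.point z') (by rw [h0]; rfl)

/-- A nonvanishing smooth section of `L_d` near the point `z`. -/
def smoothFrameAt (d : ℤ) (z : M) : ∀ z, S.L d z := (S.exists_smoothFrame d z).choose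

/-- The Dolbeault operator of the holomorphic line bundle `L_d`: if `θ = f • e` near `z` with a
local holomorphic frame `e`, then `∂̄θ = ∂̄f • e`. The value does not depend on `e`. -/
def dbarL {d : ℤ} (θ : ∀ z, S.L d z) (z : M) (v : TangentSpace 𝓘(ℝ, ℂ) z) : S.L d z :=
  dbarFun (fun z' => S.ratio (S.holFrameAt d z z') (θ z')) z v • S.holFrameAt d z z

/-- The family `Φ` of linear isomorphisms `(L_d)_z → (L_d)_{m z}` is a lift `√dm ^ d` of the
differential `dm`: there is a continuous bundle isomorphism `Ψ = √dm` of `L_1` covering `m` whose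
square is the differential `dm` of `TM = (L_1)^2`, and `Φ` is the `d`-th power of `Ψ`. -/
def IsSqrtDifferentialPow (d : ℤ) (m : M ≃ₘ^∞⟮𝓘(ℝ, ℂ), 𝓘(ℝ, ℂ)⟯ M)
    (Φ : ∀ z, S.L d z ≃ₗ[ℂ] S.L d (m z)) : Prop :=
  ∃ Ψ : ∀ z, S.L 1 z ≃ₗ[ℂ] S.L 1 (m z),
    (∀ (a : ∀ z, S.L 1 z) (U : Set M), IsOpen U → S.IsContSection a U →
      S.IsContSection (fun z => (Ψ z).symm (a (m z))) (m ⁻¹' U)) ∧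
    (∀ (z : M) (a : S.L 1 z), S.sq (Ψ z a) = mfderiv 𝓘(ℝ, ℂ) 𝓘(ℝ, ℂ) m z (S.sq a)) ∧
    ∀ (z : M) (a : S.L 1 z), a ≠ 0 → Φ z (S.pow d a) = S.pow d (Ψ z a)

end SpinStructure

end Spin

/-! ### Almost complex manifolds and connections -/

section Target

variable {E : Type*} [NormedAddCommGroup E] [NormedSpace ℝ E]
  {X : Type*} [TopologicalSpace X] [ChartedSpace E X] [IsManifold 𝓘(ℝ, E) ∞ X]

/-- A smooth almost complex structure `J` on `X`. -/
structure AlmostComplexStructure (E : Type*) [NormedAddCommGroup E] [NormedSpace ℝ E]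
    (X : Type*) [TopologicalSpace X] [ChartedSpace E X] [IsManifold 𝓘(ℝ, E) ∞ X] where
  /-- the endomorphism field -/
  toFun : ∀ x : X, TangentSpace 𝓘(ℝ, E) x →L[ℝ] TangentSpace 𝓘(ℝ, E) x
  apply_apply : ∀ x v, toFun x (toFun x v) = -v
  smooth : ContMDiff 𝓘(ℝ, E) (𝓘(ℝ, E).prod 𝓘(ℝ, E →L[ℝ] E)) ∞
    (fun x => Bundle.TotalSpace.mk' (E →L[ℝ] E)
      (E := fun x : X => TangentSpace 𝓘(ℝ, E) x →L[ℝ] TangentSpace 𝓘(ℝ, E) x) x (toFun x))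

/-- Complex scalar multiplication on `T_x X` by means of `J`: `(s + i t) v = s v + t J v`. -/
def complexSMul (J : AlmostComplexStructure E X) (x : X) (c : ℂ) (v : TangentSpace 𝓘(ℝ, E) x) :
    TangentSpace 𝓘(ℝ, E) x :=
  c.re • v + c.im • J.toFun x v

/-- The tangent space of `X` at `x`, considered as a complex vector space by means of `J`. -/
def CTangent (_J : AlmostComplexStructure E X) (x : X) : Type _ := TangentSpace 𝓘(ℝ, E) x

instance (J : AlmostComplexStructure E X) (x : X) : AddCommGroup (CTangent J x) :=
  inferInstanceAs (AddCommGroup (TangentSpace 𝓘(ℝ, E) x))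

/-- A tangent vector as an element of the complex vector space `(T_x X, J)`. -/
def toC (J : AlmostComplexStructure E X) (x : X) (v : TangentSpace 𝓘(ℝ, E) x) : CTangent J x := v

/-- An element of the complex vector space `(T_x X, J)` as a tangent vector. -/
def ofC (J : AlmostComplexStructure E X) (x : X) (v : CTangent J x) : TangentSpace 𝓘(ℝ, E) x := v

instance (J : AlmostComplexStructure E X) (x : X) : Module ℂ (CTangent J x) where
  smul c v := toC J x (complexSMul J x c (ofC J x v))
  one_smul v := by
    change complexSMul J x 1 (ofC J x v) = ofC J x v
    simp [complexSMul]
  mul_smul c c' v := by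
    change complexSMul J x (c * c') (ofC J x v) =
      complexSMul J x c (complexSMul J x c' (ofC J x v))
    simp only [complexSMul, Complex.mul_re, Complex.mul_im, map_add, map_smul, J.apply_apply]
    module
  smul_zero c := by
    change complexSMul J x c 0 = 0
    simp [complexSMul]
  smul_add c v w := by
    change complexSMul J x c (ofC J x v + ofC J x w) =
      complexSMul J x c (ofC J x v) + complexSMul J x c (ofC J x w)
    simp only [complexSMul, map_add]
    module
  add_smul c c' v := by
    change complexSMul J x (c + c') (ofC J x v) =
      complexSMul J x c (ofC J x v) + complexSMul J x c' (ofC J x v)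
    simp only [complexSMul, Complex.add_re, Complex.add_im]
    module
  zero_smul v := by
    change complexSMul J x 0 (ofC J x v) = 0
    simp [complexSMul]

/-- The connection `∇^{A,J} = ∇^A - ½ J (∇^A J)`, written as `½ (∇^A σ - J ∇^A (J σ))`:
the part of the connection `A` on `TX` that commutes with `J`. -/
def covAJ (A : CovariantDerivative 𝓘(ℝ, E) E (fun x : X => TangentSpace 𝓘(ℝ, E) x))
    (J : AlmostComplexStructure E X) (σ : ∀ x : X, TangentSpace 𝓘(ℝ, E) x) (x : X)
    (v : TangentSpace 𝓘(ℝ, E) x) : TangentSpace 𝓘(ℝ, E) x :=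
  (1 / 2 : ℝ) • (A σ x v - J.toFun x (A (fun y => J.toFun y (σ y)) x v))

/-- The vector field with constant coefficients in the preferred coordinates near `x` that extends
the tangent vector `w` at `x`. -/
def constField (x : X) (w : TangentSpace 𝓘(ℝ, E) x) (y : X) : TangentSpace 𝓘(ℝ, E) y :=
  (trivializationAt E (TangentSpace 𝓘(ℝ, E)) x).symm y
    (trivializationAt E (TangentSpace 𝓘(ℝ, E)) x ⟨x, w⟩).2

end Target

/-! ### Maps from a surface, sections along maps, and the operators -/

section Curves

variable {M : Type*} [TopologicalSpace M] [ChartedSpace ℂ M] [IsManifold 𝓘(ℂ, ℂ) ω M]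
  {E : Type*} [NormedAddCommGroup E] [NormedSpace ℝ E]
  {X : Type*} [TopologicalSpace X] [ChartedSpace E X] [IsManifold 𝓘(ℝ, E) ∞ X]

/-- Smoothness on `U` of a section `ξ` of `φ^* TX`. -/
def IsSmoothAlong (φ : M → X) (ξ : ∀ z, TangentSpace 𝓘(ℝ, E) (φ z)) (U : Set M) : Prop :=
  ContMDiffOn 𝓘(ℝ, ℂ) 𝓘(ℝ, E).tangent ∞
    (fun z => (⟨φ z, ξ z⟩ : TangentBundle 𝓘(ℝ, E) X)) U

/-- The pullback to `φ^* TX` of the connection `∇^{A,J}`, applied to the section `ξ` at `z` in the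
direction `v`. Writing `ξ = ∑ ξ^i (∂_i ∘ φ)` with the coordinate fields near `φ z`, it is
`∑ dξ^i(v) ∂_i + ∑ ξ^i(z) ∇_{dφ(v)} ∂_i`. -/
def pullbackCov (A : CovariantDerivative 𝓘(ℝ, E) E (fun x : X => TangentSpace 𝓘(ℝ, E) x))
    (J : AlmostComplexStructure E X) (φ : M → X) (ξ : ∀ z, TangentSpace 𝓘(ℝ, E) (φ z))
    (z : M) (v : TangentSpace 𝓘(ℝ, ℂ) z) : TangentSpace 𝓘(ℝ, E) (φ z) :=
  (trivializationAt E (TangentSpace 𝓘(ℝ, E)) (φ z)).symm (φ z)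
      (mvfderiv 𝓘(ℝ, ℂ) (fun z' =>
        (trivializationAt E (TangentSpace 𝓘(ℝ, E)) (φ z) ⟨φ z', ξ z'⟩).2) z v)
    + covAJ A J (constField (φ z) (ξ z)) (φ z) (mfderiv 𝓘(ℝ, ℂ) 𝓘(ℝ, E) φ z v)

/-- The `(0,1)`-part `½ (∇ξ + J ∘ ∇ξ ∘ j)` of the covariant derivative `∇^{A,J} ξ`. -/
def pullbackCov01 (A : CovariantDerivative 𝓘(ℝ, E) E (fun x : X => TangentSpace 𝓘(ℝ, E) x))
    (J : AlmostComplexStructure E X) (φ : M → X) (ξ : ∀ z, TangentSpace 𝓘(ℝ, E) (φ z))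
    (z : M) (v : TangentSpace 𝓘(ℝ, ℂ) z) : TangentSpace 𝓘(ℝ, E) (φ z) :=
  (1 / 2 : ℝ) • (pullbackCov A J φ ξ z v
    + J.toFun (φ z) (pullbackCov A J φ ξ z (cmul Complex.I v)))

/-- The operator `∂̄_J φ = ½ (dφ + J ∘ dφ ∘ j)`. -/
def dbarJ (J : AlmostComplexStructure E X) (φ : M → X) (z : M) (v : TangentSpace 𝓘(ℝ, ℂ) z) :
    TangentSpace 𝓘(ℝ, E) (φ z) :=
  (1 / 2 : ℝ) • (mfderiv 𝓘(ℝ, ℂ) 𝓘(ℝ, E) φ z v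
    + J.toFun (φ z) (mfderiv 𝓘(ℝ, ℂ) 𝓘(ℝ, E) φ z (cmul Complex.I v)))

variable {h : SurfaceMetric M} {P : Type*} [TopologicalSpace P] [MulAction Circle P]
  (S : SpinStructure h P)

/-- The fibre at `z` of the complex vector bundle `L_d ⊗_J φ^* TX`. -/
abbrev TwistedFib (d : ℤ) (J : AlmostComplexStructure E X) (φ : M → X) (z : M) : Type _ :=
  S.L d z ⊗[ℂ] CTangent J (φ z)

/-- The component `ψ_θ` of `ψ` with respect to the section `θ` of `L_d`, so that
`ψ = θ ⊗ ψ_θ` wherever `θ` does not vanish. -/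
def component {d : ℤ} {J : AlmostComplexStructure E X} {φ : M → X} (θ : ∀ z, S.L d z)
    (ψ : ∀ z, TwistedFib S d J φ z) (z : M) : TangentSpace 𝓘(ℝ, E) (φ z) :=
  ofC J (φ z) (TensorProduct.lid ℂ (CTangent J (φ z))
    (LinearMap.rTensor (CTangent J (φ z)) (S.ratio (θ z)) (ψ z)))

/-- Smoothness on `U` of a section `ψ` of `L_d ⊗_J φ^* TX`: its components with respect to
nonvanishing smooth local sections of `L_d` are smooth. -/
def IsSmoothTwisted {d : ℤ} {J : AlmostComplexStructure E X} {φ : M → X}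
    (ψ : ∀ z, TwistedFib S d J φ z) (U : Set M) : Prop :=
  ∀ (θ : ∀ z, S.L d z) (W : Set M), S.IsSmoothFrame θ W →
    IsSmoothAlong φ (component S θ ψ) (U ∩ W)

/-- `η` is an element of `Ω^{0,1}(L_d ⊗_J φ^* TX)`, i.e. a smooth one-form with values in
`L_d ⊗_J φ^* TX` that is complex antilinear. -/
def IsZeroOneForm {d : ℤ} {J : AlmostComplexStructure E X} {φ : M → X}
    (η : ∀ z, TangentSpace 𝓘(ℝ, ℂ) z → TwistedFib S d J φ z) : Prop :=
  (∀ z v w, η z (v + w) = η z v + η z w) ∧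
  (∀ z (c : ℂ) v, η z (cmul c v) = (starRingEnd ℂ c) • η z v) ∧
  ∀ (V : ∀ z : M, TangentSpace 𝓘(ℝ, ℂ) z) (U : Set M), IsOpen U →
    ContMDiffOn 𝓘(ℝ, ℂ) 𝓘(ℝ, ℂ).tangent ∞
      (fun z => (⟨z, V z⟩ : TangentBundle 𝓘(ℝ, ℂ) M)) U →
    IsSmoothTwisted S (fun z => η z (V z)) U

/-- The operator `D^{A,J}_φ` on sections of `L_d ⊗_J φ^* TX`: with a nonvanishing section `θ` of
`L_d` near `z` and `ψ = θ ⊗ ψ_θ`, it is `θ ⊗ (∇^{A,J} ψ_θ)^{0,1} + ∂̄θ ⊗ ψ_θ` at `z`.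
The value on smooth sections does not depend on `θ`. -/
def superD (A : CovariantDerivative 𝓘(ℝ, E) E (fun x : X => TangentSpace 𝓘(ℝ, E) x))
    {d : ℤ} {J : AlmostComplexStructure E X} {φ : M → X} (ψ : ∀ z, TwistedFib S d J φ z)
    (z : M) (v : TangentSpace 𝓘(ℝ, ℂ) z) : TwistedFib S d J φ z :=
  let θ := S.smoothFrameAt d z
  θ z ⊗ₜ[ℂ] toC J (φ z) (pullbackCov01 A J φ (component S θ ψ) z v)
    + S.dbarL θ z v ⊗ₜ[ℂ] toC J (φ z) (component S θ ψ z)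

/-- The isomorphism `Φ_m^{-1} : (L_d)_{m z} ⊗ T_{φ (m z)} X → (L_d)_z ⊗ T_{φ (m z)} X`. -/
def liftInv {d : ℤ} {J : AlmostComplexStructure E X} {φ : M → X}
    {m : M ≃ₘ^∞⟮𝓘(ℝ, ℂ), 𝓘(ℝ, ℂ)⟯ M} (Φ : ∀ z, S.L d z ≃ₗ[ℂ] S.L d (m z)) (z : M) :
    TwistedFib S d J φ (m z) →ₗ[ℂ] TwistedFib S d J (φ ∘ m) z :=
  LinearMap.rTensor (CTangent J (φ (m z))) ((Φ z).symm : S.L d (m z) →ₗ[ℂ] S.L d z)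

/-- The transformed section `Φ_m^{-1} ∘ ψ ∘ m` of `L_d ⊗_J (φ ∘ m)^* TX`. -/
def transform {d : ℤ} {J : AlmostComplexStructure E X} {φ : M → X}
    {m : M ≃ₘ^∞⟮𝓘(ℝ, ℂ), 𝓘(ℝ, ℂ)⟯ M} (Φ : ∀ z, S.L d z ≃ₗ[ℂ] S.L d (m z))
    (ψ : ∀ z, TwistedFib S d J φ z) (z : M) : TwistedFib S d J (φ ∘ m) z :=
  liftInv S Φ z (ψ (m z))

end Curves

end Supercurve

end

/-!
The two operators are local in the source, and a conformal automorphism with a lift to `L_1` is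
holomorphic: every tangent vector is a square `sq a` and `dm (sq a) = sq (Ψ a)` for a complex linear
`Ψ`, so `dm` is complex linear (`SpinStructure.IsSqrtDifferentialPow.isComplexLinear`). The
transformation law is then naturality under pullback, once everything is expressed by frames which
are themselves pulled back.

* The pulled back connection `∇^{A,J}` can be computed with an arbitrary local family of vector
  fields on the target (`pullbackCov_eq_sum`), because `∇^{A,J}` is a covariant derivative. As it
  commutes with `J`, its pullback satisfies the Leibniz rule for complex valued functions
  (`pullbackCov_complexSMul`); it preserves smoothness (`isSmoothAlong_pullbackCov`); and it is
  natural under maps of the source by the chain rule (`pullbackCov_comp`).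
* Two local holomorphic frames of `L_1` differ by a continuous function whose square, a quotient of
  holomorphic vector fields, is holomorphic; hence the function is holomorphic
  (`SpinStructure.IsHolRoot.mdifferentiableAt_ratio`). So the Dolbeault operator of `L_d` does not
  depend on the holomorphic frame and obeys the Leibniz rule (`SpinStructure.dbarL_eq`,
  `SpinStructure.dbarL_eq_ratio`).
* By the two Leibniz rules `D^{A,J}` can be computed with an arbitrary smooth frame of `L_d`
  (`superD_eq`). With a holomorphic frame one sees that it takes values in smooth `(0,1)`-forms.
* The pullback `Φ⁻¹ ∘ e ∘ m` of a holomorphic (smooth) frame is holomorphic (smooth), and the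
  component of `Φ⁻¹ ∘ ψ ∘ m` with respect to `Φ⁻¹ ∘ θ ∘ m` is `ψ_θ ∘ m`. Computing one side with `θ`
  and the other with its pullback gives `superD_transform`. The invariance of the equations follows
  because `m`, `dm` and `Φ` are bijective.
-/

open scoped Manifold ContDiff Topology TensorProduct Bundle

noncomputable section

namespace Supercurve

/-! ### Derivatives of vector valued functions -/

section Pullback

variable {M : Type*} [TopologicalSpace M] [ChartedSpace ℂ M]
  {E : Type*} [NormedAddCommGroup E] [NormedSpace ℝ E]
  {X : Type*} [TopologicalSpace X] [ChartedSpace E X] [IsManifold 𝓘(ℝ, E) ∞ X]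

section General

variable {H : Type*} [NormedAddCommGroup H] [NormedSpace ℝ H]
  {N : Type*} [TopologicalSpace N] [ChartedSpace H N]

theorem mvfderiv_finset_sum {ι : Type*} (s : Finset ι) {f : ι → N → E} {z : N}
    (hf : ∀ i ∈ s, MDifferentiableAt 𝓘(ℝ, H) 𝓘(ℝ, E) (f i) z) :
    MDifferentiableAt 𝓘(ℝ, H) 𝓘(ℝ, E) (fun y => ∑ i ∈ s, f i y) z ∧
      mvfderiv 𝓘(ℝ, H) (fun y => ∑ i ∈ s, f i y) z = ∑ i ∈ s, mvfderiv 𝓘(ℝ, H) (f i) z := by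
  classical
  induction s using Finset.induction_on with
  | empty => exact ⟨by simpa using mdifferentiableAt_const, by simp [mvfderiv_const]⟩
  | insert i s hi ih =>
    obtain ⟨h1, h2⟩ := ih fun j hj => hf j (Finset.mem_insert_of_mem hj)
    have h3 := hf i (Finset.mem_insert_self i s)
    simp only [Finset.sum_insert hi]
    exact ⟨h3.add h1, by rw [mvfderiv_fun_add h3 h1, h2]⟩

theorem mvfderiv_congr {f g : N → E} {z : N} (h : f =ᶠ[𝓝 z] g) :
    mvfderiv 𝓘(ℝ, H) f z = mvfderiv 𝓘(ℝ, H) g z := by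
  ext v
  change mfderiv 𝓘(ℝ, H) 𝓘(ℝ, E) f z v = mfderiv 𝓘(ℝ, H) 𝓘(ℝ, E) g z v
  rw [h.mfderiv_eq]
  rfl

/-- A linear map on the target commutes with the differential. -/
theorem mvfderiv_clm_comp {F : Type*} [NormedAddCommGroup F] [NormedSpace ℝ F] (l : E →L[ℝ] F)
    {f : N → E} {z : N} (hf : MDifferentiableAt 𝓘(ℝ, H) 𝓘(ℝ, E) f z) (v : TangentSpace 𝓘(ℝ, H) z) :
    mvfderiv 𝓘(ℝ, H) (fun y => l (f y)) z v = l (mvfderiv 𝓘(ℝ, H) f z v) := by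
  have h1 := (l.hasMFDerivAt (x := f z)).comp z hf.hasMFDerivAt
  change mfderiv 𝓘(ℝ, H) 𝓘(ℝ, F) (l ∘ f) z v = _
  rw [h1.mfderiv]
  rfl

theorem mvfderiv_comp_map {H' N' : Type*} [NormedAddCommGroup H'] [NormedSpace ℝ H']
    [TopologicalSpace N'] [ChartedSpace H' N'] {u : N → E} {φ : N' → N} {z : N'}
    (hu : MDifferentiableAt 𝓘(ℝ, H) 𝓘(ℝ, E) u (φ z))
    (hφ : MDifferentiableAt 𝓘(ℝ, H') 𝓘(ℝ, H) φ z) (v : TangentSpace 𝓘(ℝ, H') z) :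
    mvfderiv 𝓘(ℝ, H') (fun y => u (φ y)) z v
      = mvfderiv 𝓘(ℝ, H) u (φ z) (mfderiv 𝓘(ℝ, H') 𝓘(ℝ, H) φ z v) := by
  change mfderiv 𝓘(ℝ, H') 𝓘(ℝ, E) (u ∘ φ) z v = _
  rw [(hu.hasMFDerivAt.comp z hφ.hasMFDerivAt).mfderiv]
  rfl

end General

/-! ### Coordinates of tangent vectors -/

/-- The coordinates of the tangent vector `w` at `y` in the preferred chart at `x`. -/
def vcoord (x y : X) (w : TangentSpace 𝓘(ℝ, E) y) : E :=
  (trivializationAt E (TangentSpace 𝓘(ℝ, E) : X → Type _) x ⟨y, w⟩).2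

/-- The tangent vector at `y` with coordinates `c` in the preferred chart at `x`
(and `0` where that chart is not defined). -/
def ofCoord (x : X) (c : E) (y : X) : TangentSpace 𝓘(ℝ, E) y :=
  (trivializationAt E (TangentSpace 𝓘(ℝ, E) : X → Type _) x).symm y c

theorem vcoord_add {x y : X} (hy : y ∈ (chartAt E x).source) (w w' : TangentSpace 𝓘(ℝ, E) y) :
    vcoord x y (w + w') = vcoord x y w + vcoord x y w' :=
  ((trivializationAt E (TangentSpace 𝓘(ℝ, E) : X → Type _) x).linear ℝ hy).map_add w w'

theorem vcoord_smul {x y : X} (hy : y ∈ (chartAt E x).source) (c : ℝ)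
    (w : TangentSpace 𝓘(ℝ, E) y) : vcoord x y (c • w) = c • vcoord x y w :=
  ((trivializationAt E (TangentSpace 𝓘(ℝ, E) : X → Type _) x).linear ℝ hy).map_smul c w

theorem vcoord_sum {x y : X} (hy : y ∈ (chartAt E x).source) {ι : Type*} (s : Finset ι)
    (w : ι → TangentSpace 𝓘(ℝ, E) y) :
    vcoord x y (∑ i ∈ s, w i) = ∑ i ∈ s, vcoord x y (w i) :=
  map_sum (((trivializationAt E (TangentSpace 𝓘(ℝ, E) : X → Type _) x).linear ℝ hy).mk' _) w s

theorem ofCoord_vcoord {x y : X} (hy : y ∈ (chartAt E x).source) (w : TangentSpace 𝓘(ℝ, E) y) :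
    ofCoord x (vcoord x y w) y = w :=
  (trivializationAt E (TangentSpace 𝓘(ℝ, E) : X → Type _) x).symm_apply_apply_mk hy w

theorem vcoord_ofCoord {x y : X} (hy : y ∈ (chartAt E x).source) (c : E) :
    vcoord x y (ofCoord x c y) = c :=
  congrArg Prod.snd
    ((trivializationAt E (TangentSpace 𝓘(ℝ, E) : X → Type _) x).apply_mk_symm hy c)

theorem vcoord_injective {x y : X} (hy : y ∈ (chartAt E x).source) :
    Function.Injective (vcoord x y : TangentSpace 𝓘(ℝ, E) y → E) :=
  Function.LeftInverse.injective (g := fun c => ofCoord x c y) (ofCoord_vcoord hy)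

theorem ofCoord_add {x y : X} (hy : y ∈ (chartAt E x).source) (c c' : E) :
    ofCoord x (c + c') y = ofCoord x c y + ofCoord x c' y :=
  vcoord_injective hy (by simp only [vcoord_add hy, vcoord_ofCoord hy])

theorem ofCoord_smul {x y : X} (hy : y ∈ (chartAt E x).source) (r : ℝ) (c : E) :
    ofCoord x (r • c) y = r • ofCoord x c y :=
  vcoord_injective hy (by simp only [vcoord_smul hy, vcoord_ofCoord hy])

theorem ofCoord_sum {x y : X} (hy : y ∈ (chartAt E x).source) {ι : Type*} (s : Finset ι)
    (c : ι → E) : ofCoord x (∑ i ∈ s, c i) y = ∑ i ∈ s, ofCoord x (c i) y :=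
  vcoord_injective hy (by simp only [vcoord_sum hy, vcoord_ofCoord hy])

theorem constField_eq (x : X) (w : TangentSpace 𝓘(ℝ, E) x) :
    constField x w = ofCoord x (vcoord x x w) := rfl

theorem mdifferentiableAt_ofCoord (x : X) (c : E) :
    MDifferentiableAt 𝓘(ℝ, E) 𝓘(ℝ, E).tangent
      (fun y => (⟨y, ofCoord x c y⟩ : TangentBundle 𝓘(ℝ, E) X)) x := by
  have h := FiberBundle.mdifferentiableAt_extend 𝓘(ℝ, E) E
    (V := (TangentSpace 𝓘(ℝ, E) : X → Type _)) (ofCoord x c x)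
  have h2 : FiberBundle.extend E (ofCoord x c x) = ofCoord x c := by
    change ofCoord x (vcoord x x (ofCoord x c x)) = _
    rw [vcoord_ofCoord (mem_chart_source E x)]
  rwa [h2] at h

/-! ### Covariant derivatives in coordinates -/

theorem cov_finset_sum
    (C : CovariantDerivative 𝓘(ℝ, E) E (fun x : X => TangentSpace 𝓘(ℝ, E) x)) {x : X}
    {ι : Type*} (t : Finset ι) {σ : ι → ∀ y : X, TangentSpace 𝓘(ℝ, E) y}
    (hσ : ∀ i, MDifferentiableAt 𝓘(ℝ, E) 𝓘(ℝ, E).tangent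
      (fun y => (⟨y, σ i y⟩ : TangentBundle 𝓘(ℝ, E) X)) x) :
    C (∑ i ∈ t, σ i) x = ∑ i ∈ t, C (σ i) x := by
  classical
  induction t using Finset.induction_on with
  | empty => simp
  | insert i t hi ih =>
    rw [Finset.sum_insert hi, Finset.sum_insert hi, ← ih,
      C.isCovariantDerivativeOnUniv.add (hσ i)]
    have h := MDifferentiableAt.sum_section (s := t) fun i _ => hσ i
    simpa only [Finset.sum_apply] using h

/-- The covariant derivative at `x` of the fields with constant coefficients in the chart at `x`
is linear in the coefficients. -/
theorem cov_ofCoord_sum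
    (C : CovariantDerivative 𝓘(ℝ, E) E (fun x : X => TangentSpace 𝓘(ℝ, E) x)) (x : X)
    {ι : Type*} (t : Finset ι) (r : ι → ℝ) (c : ι → E) :
    C (ofCoord x (∑ i ∈ t, r i • c i)) x = ∑ i ∈ t, r i • C (ofCoord x (c i)) x := by
  have hC := C.isCovariantDerivativeOnUniv
  have hd := fun i => mdifferentiableAt_ofCoord (E := E) x (c i)
  have hrd := fun i => (hd i).smul_const_section (a := r i)
  have e : C (ofCoord x (∑ i ∈ t, r i • c i)) x = C (∑ i ∈ t, r i • ofCoord x (c i)) x := by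
    refine hC.congr_of_eventuallyEq (mdifferentiableAt_ofCoord x _) ?_ Filter.univ_mem ?_
    · have h := MDifferentiableAt.sum_section (s := t) fun i _ => hrd i
      simpa only [Finset.sum_apply] using h
    · filter_upwards [(chartAt E x).open_source.mem_nhds (mem_chart_source E x)] with y hy
      rw [Finset.sum_apply, ofCoord_sum hy]
      exact Finset.sum_congr rfl fun i _ => ofCoord_smul hy _ _
  rw [e, cov_finset_sum C t hrd]
  exact Finset.sum_congr rfl fun i _ => hC.smul_const _ (hd i)

/-- The formula for a covariant derivative in coordinates: differentiating the coefficients, plus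
the derivative of the field with constant coefficients. -/
theorem cov_eq_coord [FiniteDimensional ℝ E]
    (C : CovariantDerivative 𝓘(ℝ, E) E (fun x : X => TangentSpace 𝓘(ℝ, E) x))
    {s : ∀ x : X, TangentSpace 𝓘(ℝ, E) x} {x : X}
    (hs : MDifferentiableAt 𝓘(ℝ, E) 𝓘(ℝ, E).tangent
      (fun y => (⟨y, s y⟩ : TangentBundle 𝓘(ℝ, E) X)) x) (w : TangentSpace 𝓘(ℝ, E) x) :
    C s x w = ofCoord x (mvfderiv 𝓘(ℝ, E) (fun y => vcoord x y (s y)) x w) x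
      + C (constField x (s x)) x w := by
  classical
  let b := Module.finBasis ℝ E
  let S : X → E := fun y => vcoord x y (s y)
  have hx := mem_chart_source E x
  have hS : MDifferentiableAt 𝓘(ℝ, E) 𝓘(ℝ, E) S x :=
    ((mdifferentiableAt_totalSpace 𝓘(ℝ, E) _).1 hs).2
  -- the coefficients with respect to the coordinate fields
  let l : Fin (Module.finrank ℝ E) → E →L[ℝ] ℝ := fun i => (b.coord i).toContinuousLinearMap
  have hl : ∀ c : E, ∑ i, l i c • b i = c := fun c => b.sum_repr c
  let f : Fin (Module.finrank ℝ E) → X → ℝ := fun i y => l i (S y)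
  have hf : ∀ i, MDifferentiableAt 𝓘(ℝ, E) 𝓘(ℝ, ℝ) (f i) x := fun i =>
    (l i).mdifferentiableAt.comp x hS
  have hC := C.isCovariantDerivativeOnUniv
  have hd := fun i => mdifferentiableAt_ofCoord (E := E) x (b i)
  have hfd : ∀ i, MDifferentiableAt 𝓘(ℝ, E) 𝓘(ℝ, E).tangent
      (fun y => (⟨y, (f i • ofCoord x (b i)) y⟩ : TangentBundle 𝓘(ℝ, E) X)) x := fun i =>
    (hf i).smul_section (hd i)
  have e1 : C s x = C (∑ i, f i • ofCoord x (b i)) x := by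
    refine hC.congr_of_eventuallyEq hs ?_ Filter.univ_mem ?_
    · have h := MDifferentiableAt.sum_section (s := Finset.univ) fun i _ => hfd i
      simpa only [Finset.sum_apply] using h
    · filter_upwards [(chartAt E x).open_source.mem_nhds hx] with y hy
      rw [Finset.sum_apply]
      refine (ofCoord_vcoord hy (s y)).symm.trans ?_
      change ofCoord x (S y) y = _
      conv_lhs => rw [← hl (S y), ofCoord_sum hy]
      exact Finset.sum_congr rfl fun i _ => ofCoord_smul hy _ _
  have e2 : C (constField x (s x)) x = ∑ i, f i x • C (ofCoord x (b i)) x := by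
    rw [← cov_ofCoord_sum]
    exact congrArg (fun c => C (ofCoord x c) x) (hl (S x)).symm
  rw [e1, e2, cov_finset_sum C _ hfd]
  simp only [sum_apply]
  have e3 : ofCoord x (mvfderiv 𝓘(ℝ, E) S x w) x
      = ∑ i, mvfderiv 𝓘(ℝ, E) (f i) x w • ofCoord x (b i) x := by
    conv_lhs => rw [← hl (mvfderiv 𝓘(ℝ, E) S x w), ofCoord_sum hx]
    refine Finset.sum_congr rfl fun i _ => ?_
    rw [ofCoord_smul hx, mvfderiv_clm_comp (l i) hS]
  rw [e3, ← Finset.sum_add_distrib]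
  refine Finset.sum_congr rfl fun i _ => ?_
  rw [hC.leibniz (hd i) (hf i)]
  simp only [add_apply, smul_apply,
    ContinuousLinearMap.smulRight_apply]
  exact add_comm _ _

end Pullback

/-! ### The connection `∇^{A,J}` and its pullback -/

section PullbackAJ

variable {M : Type*} [TopologicalSpace M] [ChartedSpace ℂ M]
  {E : Type*} [NormedAddCommGroup E] [NormedSpace ℝ E]
  {X : Type*} [TopologicalSpace X] [ChartedSpace E X] [IsManifold 𝓘(ℝ, E) ∞ X]
  (A : CovariantDerivative 𝓘(ℝ, E) E (fun x : X => TangentSpace 𝓘(ℝ, E) x))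
  (J : AlmostComplexStructure E X)

theorem AlmostComplexStructure.mdifferentiableAt_comp {s : ∀ x : X, TangentSpace 𝓘(ℝ, E) x} {x : X}
    (hs : MDifferentiableAt 𝓘(ℝ, E) 𝓘(ℝ, E).tangent
      (fun y => (⟨y, s y⟩ : TangentBundle 𝓘(ℝ, E) X)) x) :
    MDifferentiableAt 𝓘(ℝ, E) 𝓘(ℝ, E).tangent
      (fun y => (⟨y, J.toFun y (s y)⟩ : TangentBundle 𝓘(ℝ, E) X)) x :=
  ((J.smooth x).mdifferentiableAt (by simp)).clm_bundle_apply hs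

theorem AlmostComplexStructure.contMDiff_comp {s : ∀ x : X, TangentSpace 𝓘(ℝ, E) x}
    (hs : ContMDiff 𝓘(ℝ, E) 𝓘(ℝ, E).tangent ∞
      (fun y => (⟨y, s y⟩ : TangentBundle 𝓘(ℝ, E) X))) :
    ContMDiff 𝓘(ℝ, E) 𝓘(ℝ, E).tangent ∞
      (fun y => (⟨y, J.toFun y (s y)⟩ : TangentBundle 𝓘(ℝ, E) X)) :=
  J.smooth.clm_bundle_apply hs

/-- The connection `∇^{A,J}` is a covariant derivative. -/
def covAJConn : CovariantDerivative 𝓘(ℝ, E) E (fun x : X => TangentSpace 𝓘(ℝ, E) x) where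
  toFun σ x := (1 / 2 : ℝ) • (A σ x - (J.toFun x).comp (A (fun y => J.toFun y (σ y)) x))
  isCovariantDerivativeOnUniv :=
    { add := by
        intro σ σ' x hσ hσ' _
        have h1 : (fun y => J.toFun y ((σ + σ') y))
            = (fun y => J.toFun y (σ y)) + fun y => J.toFun y (σ' y) := by
          funext y
          exact map_add _ _ _
        rw [A.isCovariantDerivativeOnUniv.add hσ hσ', h1,
          A.isCovariantDerivativeOnUniv.add (J.mdifferentiableAt_comp hσ)
            (J.mdifferentiableAt_comp hσ'), ContinuousLinearMap.comp_add]
        module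
      leibniz := by
        intro σ g x hσ hg _
        have h1 : (fun y => J.toFun y ((g • σ) y)) = g • fun y => J.toFun y (σ y) := by
          funext y
          exact map_smul _ _ _
        rw [A.isCovariantDerivativeOnUniv.leibniz hσ hg, h1,
          A.isCovariantDerivativeOnUniv.leibniz (J.mdifferentiableAt_comp hσ) hg]
        ext v
        simp only [smul_apply, sub_apply, add_apply, ContinuousLinearMap.comp_apply,
          ContinuousLinearMap.smulRight_apply, map_add, map_smul, J.apply_apply]
        module }

theorem covAJConn_apply (σ : ∀ x : X, TangentSpace 𝓘(ℝ, E) x) (x : X)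
    (v : TangentSpace 𝓘(ℝ, E) x) : covAJConn A J σ x v = covAJ A J σ x v := rfl

/-- The connection `∇^{A,J}` commutes with `J`. -/
theorem covAJ_comp {s : ∀ x : X, TangentSpace 𝓘(ℝ, E) x} {x : X}
    (hs : MDifferentiableAt 𝓘(ℝ, E) 𝓘(ℝ, E).tangent
      (fun y => (⟨y, s y⟩ : TangentBundle 𝓘(ℝ, E) X)) x) (v : TangentSpace 𝓘(ℝ, E) x) :
    covAJ A J (fun y => J.toFun y (s y)) x v = J.toFun x (covAJ A J s x v) := by
  have h1 : (fun y => J.toFun y (J.toFun y (s y))) = (-1 : ℝ) • s := by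
    funext y
    simp [J.apply_apply]
  unfold covAJ
  rw [h1, A.isCovariantDerivativeOnUniv.smul_const _ hs]
  simp only [smul_apply, map_smul, map_sub, J.apply_apply]
  module

variable [FiniteDimensional ℝ E]

/-- The pulled back connection `∇^{A,J}` in terms of an arbitrary family of vector fields `s i` on
the target: if `ξ = ∑ f i • (s i ∘ φ)`, then `∇_v ξ = ∑ df i(v) • s i + f i • ∇_{dφ(v)} (s i)`. -/
theorem pullbackCov_eq_sum {φ : M → X} {ξ : ∀ z, TangentSpace 𝓘(ℝ, E) (φ z)} {z : M}
    (hφ : MDifferentiableAt 𝓘(ℝ, ℂ) 𝓘(ℝ, E) φ z) {ι : Type*} [Fintype ι] {f : ι → M → ℝ}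
    (hf : ∀ i, MDifferentiableAt 𝓘(ℝ, ℂ) 𝓘(ℝ, ℝ) (f i) z)
    {s : ι → ∀ x : X, TangentSpace 𝓘(ℝ, E) x}
    (hs : ∀ i, MDifferentiableAt 𝓘(ℝ, E) 𝓘(ℝ, E).tangent
      (fun y => (⟨y, s i y⟩ : TangentBundle 𝓘(ℝ, E) X)) (φ z))
    (hξ : ∀ᶠ z' in 𝓝 z, ξ z' = ∑ i, f i z' • s i (φ z')) (v : TangentSpace 𝓘(ℝ, ℂ) z) :
    pullbackCov A J φ ξ z v = ∑ i, (mvfderiv 𝓘(ℝ, ℂ) (f i) z v • s i (φ z)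
      + f i z • covAJ A J (s i) (φ z) (mfderiv 𝓘(ℝ, ℂ) 𝓘(ℝ, E) φ z v)) := by
  have hx := mem_chart_source E (φ z)
  let S : ι → X → E := fun i y => vcoord (φ z) y (s i y)
  have hS : ∀ i, MDifferentiableAt 𝓘(ℝ, E) 𝓘(ℝ, E) (S i) (φ z) := fun i =>
    ((mdifferentiableAt_totalSpace 𝓘(ℝ, E) _).1 (hs i)).2
  have hSφ : ∀ i, MDifferentiableAt 𝓘(ℝ, ℂ) 𝓘(ℝ, E) (fun z' => S i (φ z')) z := fun i =>
    (hS i).comp z hφ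
  have hu : (fun z' => vcoord (φ z) (φ z') (ξ z')) =ᶠ[𝓝 z]
      fun z' => ∑ i, f i z' • S i (φ z') := by
    filter_upwards [hξ, hφ.continuousAt.preimage_mem_nhds
      ((chartAt E (φ z)).open_source.mem_nhds hx)] with z' h1 h2
    rw [h1, vcoord_sum h2]
    exact Finset.sum_congr rfl fun i _ => vcoord_smul h2 _ _
  have hsum := mvfderiv_finset_sum (f := fun i z' => f i z' • S i (φ z')) Finset.univ
    fun i _ => (hf i).smul (hSφ i)
  have h1 : pullbackCov A J φ ξ z v
      = ofCoord (φ z) (mvfderiv 𝓘(ℝ, ℂ) (fun z' => vcoord (φ z) (φ z') (ξ z')) z v) (φ z)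
        + covAJConn A J (ofCoord (φ z) (vcoord (φ z) (φ z) (ξ z))) (φ z)
          (mfderiv 𝓘(ℝ, ℂ) 𝓘(ℝ, E) φ z v) := rfl
  have hu₀ : vcoord (φ z) (φ z) (ξ z) = ∑ i, f i z • S i (φ z) := hu.self_of_nhds
  rw [h1, mvfderiv_congr hu, hsum.2, hu₀, cov_ofCoord_sum]
  simp only [sum_apply]
  rw [ofCoord_sum hx, ← Finset.sum_add_distrib]
  refine Finset.sum_congr rfl fun i _ => ?_
  rw [mvfderiv_fun_smul (hf i) (hSφ i), ← covAJConn_apply A J (s i), cov_eq_coord _ (hs i)]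
  simp only [smul_apply, add_apply, ContinuousLinearMap.smulRight_apply]
  rw [ofCoord_add hx, ofCoord_smul hx, ofCoord_smul hx, mvfderiv_comp_map (hS i) hφ,
    ofCoord_vcoord hx, constField_eq]
  module

variable [T2Space X]

/-- A vector field on `X` with constant coefficients near `x` in the chart at `x` extends to a
smooth vector field. -/
theorem exists_contMDiff_eq_ofCoord (x : X) (c : E) :
    ∃ s : ∀ y : X, TangentSpace 𝓘(ℝ, E) y,
      ContMDiff 𝓘(ℝ, E) 𝓘(ℝ, E).tangent ∞ (fun y => (⟨y, s y⟩ : TangentBundle 𝓘(ℝ, E) X)) ∧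
      ∀ᶠ y in 𝓝 x, s y = ofCoord x c y := by
  obtain ⟨χ⟩ : Nonempty (SmoothBumpFunction 𝓘(ℝ, E) x) := inferInstance
  refine ⟨(χ : X → ℝ) • ofCoord x c, ?_, ?_⟩
  · refine ContMDiffOn.smul_section_of_tsupport (u := (chartAt E x).source)
      χ.contMDiff.contMDiffOn (chartAt E x).open_source χ.tsupport_subset_chartAt_source ?_
    have h := ((trivializationAt E (TangentSpace 𝓘(ℝ, E) : X → Type _) x).contMDiffOn_section_iff
      (n := ∞) (IB := 𝓘(ℝ, E)) (s := ofCoord x c) (a := (chartAt E x).source)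
      (chartAt E x).open_source subset_rfl).2
    refine h ((contMDiffOn_const (c := c)).congr fun y hy => ?_)
    exact vcoord_ofCoord hy c
  · filter_upwards [χ.eventuallyEq_one] with y hy
    simp [hy]

/-- A smooth section along `φ` is locally a combination, with smooth coefficients, of smooth vector
fields on the target. -/
theorem exists_frame_along {φ : M → X} {ξ : ∀ z, TangentSpace 𝓘(ℝ, E) (φ z)} {U : Set M}
    (hU : IsOpen U) (hξ : IsSmoothAlong φ ξ U) {z₀ : M} (hz₀ : z₀ ∈ U) :
    ∃ (n : ℕ) (f : Fin n → M → ℝ) (s : Fin n → ∀ x : X, TangentSpace 𝓘(ℝ, E) x) (W : Set M),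
      IsOpen W ∧ z₀ ∈ W ∧ W ⊆ U ∧
      (∀ i, ContMDiffOn 𝓘(ℝ, ℂ) 𝓘(ℝ, ℝ) ∞ (f i) W) ∧
      (∀ i, ContMDiff 𝓘(ℝ, E) 𝓘(ℝ, E).tangent ∞
        (fun y => (⟨y, s i y⟩ : TangentBundle 𝓘(ℝ, E) X))) ∧
      ∀ z ∈ W, ξ z = ∑ i, f i z • s i (φ z) := by
  let b := Module.finBasis ℝ E
  let l : Fin (Module.finrank ℝ E) → E →L[ℝ] ℝ := fun i => (b.coord i).toContinuousLinearMap
  have hl : ∀ c : E, ∑ i, l i c • b i = c := fun c => b.sum_repr c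
  choose s hs hsb using fun i => exists_contMDiff_eq_ofCoord (E := E) (φ z₀) (b i)
  have hφ : ContinuousOn φ U :=
    (FiberBundle.continuous_proj E (TangentSpace 𝓘(ℝ, E) : X → Type _)).comp_continuousOn
      hξ.continuousOn
  have h1 : ∀ᶠ y in 𝓝 (φ z₀), y ∈ (chartAt E (φ z₀)).source ∧
      ∀ i, s i y = ofCoord (φ z₀) (b i) y :=
    Filter.Eventually.and ((chartAt E (φ z₀)).open_source.mem_nhds (mem_chart_source E _))
      (Filter.eventually_all.2 hsb)
  obtain ⟨B, hB, hBo, hB₀⟩ := eventually_nhds_iff.1 h1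
  have hu : ContMDiffOn 𝓘(ℝ, ℂ) 𝓘(ℝ, E) ∞ (fun z => vcoord (φ z₀) (φ z) (ξ z)) (U ∩ φ ⁻¹' B) := by
    have h2 := ((trivializationAt E (TangentSpace 𝓘(ℝ, E) : X → Type _) (φ z₀)).contMDiffOn_iff
      (n := ∞) (IB := 𝓘(ℝ, E)) (IM := 𝓘(ℝ, ℂ)) (s := U ∩ φ ⁻¹' B)
      (f := fun z => (⟨φ z, ξ z⟩ : TangentBundle 𝓘(ℝ, E) X)) ?_).1 (hξ.mono Set.inter_subset_left)
    · exact h2.2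
    · intro z hz
      rw [(trivializationAt E (TangentSpace 𝓘(ℝ, E) : X → Type _) (φ z₀)).mem_source]
      exact (hB _ hz.2).1
  refine ⟨_, fun i z => l i (vcoord (φ z₀) (φ z) (ξ z)), s, U ∩ φ ⁻¹' B,
    hφ.isOpen_inter_preimage hU hBo, ⟨hz₀, hB₀⟩, Set.inter_subset_left, ?_, hs, ?_⟩
  · intro i
    exact (l i).contDiff.contMDiff.comp_contMDiffOn hu
  · intro z hz
    obtain ⟨h2, h3⟩ := hB _ hz.2
    refine (ofCoord_vcoord h2 (ξ z)).symm.trans ?_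
    conv_lhs => rw [← hl (vcoord (φ z₀) (φ z) (ξ z)), ofCoord_sum h2]
    refine Finset.sum_congr rfl fun i _ => ?_
    rw [h3 i, ofCoord_smul h2]

/-- The Leibniz rule for multiplication by complex functions, with respect to the complex structure
`J` on the target. -/
theorem pullbackCov_complexSMul {φ : M → X} (hφ : ContMDiff 𝓘(ℝ, ℂ) 𝓘(ℝ, E) ∞ φ)
    {ξ : ∀ z, TangentSpace 𝓘(ℝ, E) (φ z)} {U : Set M}
    (hU : IsOpen U) (hξ : IsSmoothAlong φ ξ U) {z : M} (hz : z ∈ U) {g : M → ℂ}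
    (hg : MDifferentiableAt 𝓘(ℝ, ℂ) 𝓘(ℝ, ℂ) g z)
    {ξ' : ∀ z, TangentSpace 𝓘(ℝ, E) (φ z)}
    (hξ' : ∀ᶠ z' in 𝓝 z, ξ' z' = complexSMul J (φ z') (g z') (ξ z'))
    (v : TangentSpace 𝓘(ℝ, ℂ) z) :
    pullbackCov A J φ ξ' z v
      = complexSMul J (φ z) (mvfderiv 𝓘(ℝ, ℂ) g z v) (ξ z)
        + complexSMul J (φ z) (g z) (pullbackCov A J φ ξ z v) := by
  obtain ⟨n, f, s, W, hW, hzW, -, hf, hs, hsum⟩ := exists_frame_along hU hξ hz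
  have hφd := (hφ z).mdifferentiableAt (by simp)
  have hfd := fun i => ((hf i).contMDiffAt (hW.mem_nhds hzW)).mdifferentiableAt (by simp)
  have hsd := fun i => (hs i (φ z)).mdifferentiableAt (by simp)
  have hre : MDifferentiableAt 𝓘(ℝ, ℂ) 𝓘(ℝ, ℝ) (fun y => (g y).re) z :=
    Complex.reCLM.mdifferentiableAt.comp z hg
  have him : MDifferentiableAt 𝓘(ℝ, ℂ) 𝓘(ℝ, ℝ) (fun y => (g y).im) z :=
    Complex.imCLM.mdifferentiableAt.comp z hg
  have hred := mvfderiv_clm_comp Complex.reCLM hg v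
  have himd := mvfderiv_clm_comp Complex.imCLM hg v
  simp only [Complex.reCLM_apply, Complex.imCLM_apply] at hred himd
  have e1 := pullbackCov_eq_sum A J hφd hfd hsd
    (Filter.eventually_of_mem (hW.mem_nhds hzW) hsum) v
  -- `g • ξ` in terms of the fields `s i` and `J (s i)`
  have e2 := pullbackCov_eq_sum A J (ξ := ξ') (ι := Fin n ⊕ Fin n) hφd
    (f := Sum.elim (fun i y => (g y).re * f i y) fun i y => (g y).im * f i y)
    (s := Sum.elim s fun i y => J.toFun y (s i y))
    (by rintro (i | i); exacts [hre.mul (hfd i), him.mul (hfd i)])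
    (by rintro (i | i); exacts [hsd i, J.mdifferentiableAt_comp (hsd i)])
    (by
      filter_upwards [hW.mem_nhds hzW, hξ'] with y hy hy'
      rw [hy', Fintype.sum_sum_type, complexSMul, hsum y hy, Finset.smul_sum, map_sum,
        Finset.smul_sum]
      simp only [Sum.elim_inl, Sum.elim_inr, map_smul, smul_smul]) v
  rw [e2, e1, Fintype.sum_sum_type, hsum z hzW]
  simp only [complexSMul, Sum.elim_inl, Sum.elim_inr, map_sum, Finset.smul_sum,
    ← Finset.sum_add_distrib]
  refine Finset.sum_congr rfl fun i _ => ?_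
  rw [mvfderiv_fun_mul hre (hfd i), mvfderiv_fun_mul him (hfd i), covAJ_comp A J (hsd i)]
  simp only [smul_apply, add_apply, smul_eq_mul, hred, himd, map_add, map_smul]
  module

end PullbackAJ

/-! ### Smoothness of sections along a map -/

section SmoothAlong

variable {M : Type*} [TopologicalSpace M] [ChartedSpace ℂ M]
  {E : Type*} [NormedAddCommGroup E] [NormedSpace ℝ E]
  {X : Type*} [TopologicalSpace X] [ChartedSpace E X] [IsManifold 𝓘(ℝ, E) ∞ X]
  {φ : M → X} {ξ ξ' : ∀ z, TangentSpace 𝓘(ℝ, E) (φ z)} {U : Set M}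

theorem IsSmoothAlong.contMDiffOn (hξ : IsSmoothAlong φ ξ U) :
    ContMDiffOn 𝓘(ℝ, ℂ) 𝓘(ℝ, E) ∞ φ U :=
  (Bundle.contMDiff_proj (TangentSpace 𝓘(ℝ, E) : X → Type _)).comp_contMDiffOn hξ

theorem IsSmoothAlong.congr (hξ : IsSmoothAlong φ ξ U) (h : ∀ z ∈ U, ξ' z = ξ z) :
    IsSmoothAlong φ ξ' U :=
  ContMDiffOn.congr hξ fun z hz => by rw [h z hz]

theorem isSmoothAlong_of_locally
    (h : ∀ z ∈ U, ∃ W, IsOpen W ∧ z ∈ W ∧ IsSmoothAlong φ ξ (U ∩ W)) : IsSmoothAlong φ ξ U :=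
  contMDiffOn_of_locally_contMDiffOn h

theorem IsSmoothAlong.add (hξ : IsSmoothAlong φ ξ U) (hξ' : IsSmoothAlong φ ξ' U) :
    IsSmoothAlong φ (fun z => ξ z + ξ' z) U := by
  intro z hz
  have h1 := Bundle.contMDiffWithinAt_totalSpace.1 (hξ z hz)
  have h2 := Bundle.contMDiffWithinAt_totalSpace.1 (hξ' z hz)
  refine Bundle.contMDiffWithinAt_totalSpace.2 ⟨h1.1, ?_⟩
  refine (h1.2.add h2.2).congr_of_eventuallyEq_of_mem ?_ hz
  filter_upwards [h1.1.continuousWithinAt.preimage_mem_nhdsWithin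
    ((chartAt E (φ z)).open_source.mem_nhds (mem_chart_source E _))] with y hy
  exact vcoord_add hy _ _

theorem IsSmoothAlong.smul (hξ : IsSmoothAlong φ ξ U) {f : M → ℝ}
    (hf : ContMDiffOn 𝓘(ℝ, ℂ) 𝓘(ℝ, ℝ) ∞ f U) :
    IsSmoothAlong φ (fun z => f z • ξ z) U := by
  intro z hz
  have h1 := Bundle.contMDiffWithinAt_totalSpace.1 (hξ z hz)
  refine Bundle.contMDiffWithinAt_totalSpace.2 ⟨h1.1, ?_⟩
  refine ((hf z hz).smul h1.2).congr_of_eventuallyEq_of_mem ?_ hz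
  filter_upwards [h1.1.continuousWithinAt.preimage_mem_nhdsWithin
    ((chartAt E (φ z)).open_source.mem_nhds (mem_chart_source E _))] with y hy
  exact vcoord_smul hy _ _

theorem isSmoothAlong_zero (hφ : ContMDiffOn 𝓘(ℝ, ℂ) 𝓘(ℝ, E) ∞ φ U) :
    IsSmoothAlong φ (fun z => (0 : TangentSpace 𝓘(ℝ, E) (φ z))) U :=
  (Bundle.contMDiff_zeroSection ℝ (TangentSpace 𝓘(ℝ, E) : X → Type _)).comp_contMDiffOn hφ

theorem isSmoothAlong_sum (hφ : ContMDiffOn 𝓘(ℝ, ℂ) 𝓘(ℝ, E) ∞ φ U) {ι : Type*} (t : Finset ι)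
    {η : ι → ∀ z, TangentSpace 𝓘(ℝ, E) (φ z)} (h : ∀ i, IsSmoothAlong φ (η i) U) :
    IsSmoothAlong φ (fun z => ∑ i ∈ t, η i z) U := by
  classical
  induction t using Finset.induction_on with
  | empty => simpa using isSmoothAlong_zero hφ
  | insert i t hi ih => simpa only [Finset.sum_insert hi] using (h i).add ih

theorem IsSmoothAlong.comp_J (J : AlmostComplexStructure E X) (hξ : IsSmoothAlong φ ξ U) :
    IsSmoothAlong φ (fun z => J.toFun (φ z) (ξ z)) U :=
  ContMDiffOn.clm_bundle_apply (J.smooth.comp_contMDiffOn hξ.contMDiffOn) hξ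

theorem IsSmoothAlong.complexSMul (J : AlmostComplexStructure E X) (hξ : IsSmoothAlong φ ξ U)
    {g : M → ℂ} (hg : ContMDiffOn 𝓘(ℝ, ℂ) 𝓘(ℝ, ℂ) ∞ g U) :
    IsSmoothAlong φ (fun z => complexSMul J (φ z) (g z) (ξ z)) U :=
  (hξ.smul (Complex.reCLM.contDiff.contMDiff.comp_contMDiffOn hg)).add
    ((hξ.comp_J J).smul (Complex.imCLM.contDiff.contMDiff.comp_contMDiffOn hg))

variable (A : CovariantDerivative 𝓘(ℝ, E) E (fun x : X => TangentSpace 𝓘(ℝ, E) x))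
  [CovariantDerivative.ContMDiffCovariantDerivative A ∞] (J : AlmostComplexStructure E X)

theorem isSmoothAlong_cov {s : ∀ x : X, TangentSpace 𝓘(ℝ, E) x}
    (hs : ContMDiff 𝓘(ℝ, E) 𝓘(ℝ, E).tangent ∞
      (fun y => (⟨y, s y⟩ : TangentBundle 𝓘(ℝ, E) X))) (hξ : IsSmoothAlong φ ξ U) :
    IsSmoothAlong φ (fun z => A s (φ z) (ξ z)) U := by
  have h1 := (CovariantDerivative.ContMDiffCovariantDerivative.contMDiff (cov := A) (k := ∞)
    ).contMDiff (σ := s) hs.contMDiffOn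
  exact ContMDiffOn.clm_bundle_apply
    (h1.comp hξ.contMDiffOn fun _ _ => Set.mem_univ _) hξ

theorem isSmoothAlong_covAJ {s : ∀ x : X, TangentSpace 𝓘(ℝ, E) x}
    (hs : ContMDiff 𝓘(ℝ, E) 𝓘(ℝ, E).tangent ∞
      (fun y => (⟨y, s y⟩ : TangentBundle 𝓘(ℝ, E) X))) (hξ : IsSmoothAlong φ ξ U) :
    IsSmoothAlong φ (fun z => covAJ A J s (φ z) (ξ z)) U := by
  have h1 := isSmoothAlong_cov A hs hξ
  have h2 := (isSmoothAlong_cov A (J.contMDiff_comp hs) hξ).comp_J J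
  refine ((h1.add (h2.smul (f := fun _ => -1) contMDiffOn_const)).smul (f := fun _ => 1 / 2)
    contMDiffOn_const).congr fun z _ => ?_
  unfold covAJ
  module

section VectorField

variable [IsManifold 𝓘(ℝ, ℂ) ∞ M] {V : ∀ z : M, TangentSpace 𝓘(ℝ, ℂ) z}

/-- The derivative of a smooth function along a smooth vector field is smooth. -/
theorem contMDiffOn_mvfderiv_apply {F : Type*} [NormedAddCommGroup F] [NormedSpace ℝ F]
    {f : M → F} (hU : IsOpen U) (hf : ContMDiffOn 𝓘(ℝ, ℂ) 𝓘(ℝ, F) ∞ f U)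
    (hV : ContMDiffOn 𝓘(ℝ, ℂ) 𝓘(ℝ, ℂ).tangent ∞
      (fun z => (⟨z, V z⟩ : TangentBundle 𝓘(ℝ, ℂ) M)) U) :
    ContMDiffOn 𝓘(ℝ, ℂ) 𝓘(ℝ, F) ∞ (fun z => mvfderiv 𝓘(ℝ, ℂ) f z (V z)) U := by
  have h1 := hf.contMDiffOn_tangentMapWithin (m := ∞) le_rfl hU.uniqueMDiffOn
  have h2 := (contMDiff_snd_tangentBundle_modelSpace (n := ∞) F 𝓘(ℝ, F)).comp_contMDiffOn
    (h1.comp hV fun z hz => hz)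
  refine h2.congr fun z hz => ?_
  change mfderiv 𝓘(ℝ, ℂ) 𝓘(ℝ, F) f z (V z) = mfderivWithin 𝓘(ℝ, ℂ) 𝓘(ℝ, F) f U z (V z)
  rw [mfderivWithin_of_isOpen hU hz]

theorem isSmoothAlong_mfderiv_apply (hφ : ContMDiff 𝓘(ℝ, ℂ) 𝓘(ℝ, E) ∞ φ)
    (hV : ContMDiffOn 𝓘(ℝ, ℂ) 𝓘(ℝ, ℂ).tangent ∞
      (fun z => (⟨z, V z⟩ : TangentBundle 𝓘(ℝ, ℂ) M)) U) :
    IsSmoothAlong φ (fun z => mfderiv 𝓘(ℝ, ℂ) 𝓘(ℝ, E) φ z (V z)) U :=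
  (hφ.contMDiff_tangentMap (m := ∞) le_rfl).comp_contMDiffOn hV

variable [T2Space X] [FiniteDimensional ℝ E]

/-- The covariant derivative of a smooth section along `φ` in the direction of a smooth vector
field is smooth. -/
theorem isSmoothAlong_pullbackCov (hφ : ContMDiff 𝓘(ℝ, ℂ) 𝓘(ℝ, E) ∞ φ) (hU : IsOpen U)
    (hξ : IsSmoothAlong φ ξ U) (hV : ContMDiffOn 𝓘(ℝ, ℂ) 𝓘(ℝ, ℂ).tangent ∞
      (fun z => (⟨z, V z⟩ : TangentBundle 𝓘(ℝ, ℂ) M)) U) :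
    IsSmoothAlong φ (fun z => pullbackCov A J φ ξ z (V z)) U := by
  refine isSmoothAlong_of_locally fun z₀ hz₀ => ?_
  obtain ⟨n, f, s, W, hW, hzW, hWU, hf, hs, hsum⟩ := exists_frame_along hU hξ hz₀
  refine ⟨W, hW, hzW, ?_⟩
  rw [Set.inter_eq_right.2 hWU]
  have hV' := hV.mono hWU
  have h1 : IsSmoothAlong φ (fun z => ∑ i, (mvfderiv 𝓘(ℝ, ℂ) (f i) z (V z) • s i (φ z)
      + f i z • covAJ A J (s i) (φ z) (mfderiv 𝓘(ℝ, ℂ) 𝓘(ℝ, E) φ z (V z)))) W := by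
    refine isSmoothAlong_sum hφ.contMDiffOn _ fun i => ?_
    have h2 : IsSmoothAlong φ (fun z => s i (φ z)) W := (hs i).comp_contMDiffOn hφ.contMDiffOn
    exact (h2.smul (contMDiffOn_mvfderiv_apply hW (hf i) hV')).add
      ((isSmoothAlong_covAJ A J (hs i) (isSmoothAlong_mfderiv_apply hφ hV')).smul (hf i))
  refine h1.congr fun z hz => ?_
  exact pullbackCov_eq_sum A J ((hφ z).mdifferentiableAt (by simp))
    (fun i => ((hf i).contMDiffAt (hW.mem_nhds hz)).mdifferentiableAt (by simp))
    (fun i => (hs i (φ z)).mdifferentiableAt (by simp))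
    (Filter.eventually_of_mem (hW.mem_nhds hz) hsum) _

end VectorField

end SmoothAlong

/-! ### The operators in the direction of a tangent vector -/

section Directions

variable {M : Type*} [TopologicalSpace M] [ChartedSpace ℂ M]
  {E : Type*} [NormedAddCommGroup E] [NormedSpace ℝ E]
  {X : Type*} [TopologicalSpace X] [ChartedSpace E X] [IsManifold 𝓘(ℝ, E) ∞ X]

section cmul

variable {z : M} (c c' : ℂ) (v : TangentSpace 𝓘(ℝ, ℂ) z)

theorem cmul_cmul : cmul c (cmul c' v) = cmul (c * c') v :=
  (mul_assoc c c' (show ℂ from v)).symm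

theorem cmul_eq : cmul c v = c.re • v + c.im • cmul Complex.I v := by
  have h : ∀ w : ℂ, c * w = c.re • w + c.im • (Complex.I * w) := fun w => by
    conv_lhs => rw [← Complex.re_add_im c]
    simp only [Complex.real_smul]
    ring
  exact h v

theorem cmul_I_cmul_I : cmul Complex.I (cmul Complex.I v) = -v := by
  rw [cmul_cmul, Complex.I_mul_I]
  exact neg_one_mul (show ℂ from v)

end cmul

theorem contMDiffOn_cmul [IsManifold 𝓘(ℂ, ℂ) ω M] {V : ∀ z : M, TangentSpace 𝓘(ℝ, ℂ) z}
    {U : Set M} (c : ℂ)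
    (hV : ContMDiffOn 𝓘(ℝ, ℂ) 𝓘(ℝ, ℂ).tangent ∞
      (fun z => (⟨z, V z⟩ : TangentBundle 𝓘(ℝ, ℂ) M)) U) :
    ContMDiffOn 𝓘(ℝ, ℂ) 𝓘(ℝ, ℂ).tangent ∞
      (fun z => (⟨z, cmul c (V z)⟩ : TangentBundle 𝓘(ℝ, ℂ) M)) U := by
  intro z hz
  have h1 := Bundle.contMDiffWithinAt_totalSpace.1 (hV z hz)
  refine Bundle.contMDiffWithinAt_totalSpace.2 ⟨h1.1, ?_⟩
  refine ((ContinuousLinearMap.mul ℝ ℂ c).contDiff.contMDiff.contMDiffAt.comp_contMDiffWithinAt z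
    h1.2).congr_of_eventuallyEq_of_mem ?_ hz
  filter_upwards [h1.1.continuousWithinAt.preimage_mem_nhdsWithin
    ((chartAt ℂ z).open_source.mem_nhds (mem_chart_source ℂ _))] with y hy
  exact triv_cmul hy c (V y)

theorem dbarFun_add (f : M → ℂ) (z : M) (v w : TangentSpace 𝓘(ℝ, ℂ) z) :
    dbarFun f z (v + w) = dbarFun f z v + dbarFun f z w := by
  unfold dbarFun
  simp only [map_add]
  ring

theorem dbarFun_cmul (f : M → ℂ) (z : M) (c : ℂ) (v : TangentSpace 𝓘(ℝ, ℂ) z) :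
    dbarFun f z (cmul c v) = starRingEnd ℂ c * dbarFun f z v := by
  unfold dbarFun
  rw [cmul_eq c v]
  simp only [map_add, map_smul, cmul_I_cmul_I, map_neg, Complex.real_smul]
  have hc : starRingEnd ℂ c = c.re - c.im * Complex.I := by
    apply Complex.ext <;> simp
  rw [hc]
  linear_combination (1 / 2 : ℂ) * c.im * mvfderiv 𝓘(ℝ, ℂ) f z (cmul Complex.I v)
    * Complex.I_mul_I

theorem dbarFun_mul {f g : M → ℂ} {z : M} (hf : MDifferentiableAt 𝓘(ℝ, ℂ) 𝓘(ℝ, ℂ) f z)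
    (hg : MDifferentiableAt 𝓘(ℝ, ℂ) 𝓘(ℝ, ℂ) g z) (v : TangentSpace 𝓘(ℝ, ℂ) z) :
    dbarFun (fun y => f y * g y) z v = f z * dbarFun g z v + dbarFun f z v * g z := by
  have h1 : ∀ w : TangentSpace 𝓘(ℝ, ℂ) z, mvfderiv 𝓘(ℝ, ℂ) (fun y => f y * g y) z w
      = f z * mvfderiv 𝓘(ℝ, ℂ) g z w + g z * mvfderiv 𝓘(ℝ, ℂ) f z w := by
    intro w
    change mfderiv 𝓘(ℝ, ℂ) 𝓘(ℝ, ℂ) (f * g) z w = _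
    rw [(hf.hasMFDerivAt.mul hg.hasMFDerivAt).mfderiv]
    rfl
  unfold dbarFun
  rw [h1, h1]
  ring

theorem dbarFun_congr {f g : M → ℂ} {z : M} (h : f =ᶠ[𝓝 z] g) (v : TangentSpace 𝓘(ℝ, ℂ) z) :
    dbarFun f z v = dbarFun g z v := by
  unfold dbarFun
  rw [mvfderiv_congr h]

variable (A : CovariantDerivative 𝓘(ℝ, E) E (fun x : X => TangentSpace 𝓘(ℝ, E) x))
  (J : AlmostComplexStructure E X) (φ : M → X) (ξ : ∀ z, TangentSpace 𝓘(ℝ, E) (φ z))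

theorem pullbackCov_add (z : M) (v w : TangentSpace 𝓘(ℝ, ℂ) z) :
    pullbackCov A J φ ξ z (v + w) = pullbackCov A J φ ξ z v + pullbackCov A J φ ξ z w := by
  change ofCoord (φ z) (mvfderiv 𝓘(ℝ, ℂ) _ z (v + w)) (φ z) + covAJConn A J _ _ _ =
    (ofCoord (φ z) (mvfderiv 𝓘(ℝ, ℂ) _ z v) (φ z) + covAJConn A J _ _ _) +
    (ofCoord (φ z) (mvfderiv 𝓘(ℝ, ℂ) _ z w) (φ z) + covAJConn A J _ _ _)
  rw [map_add, map_add, map_add, ofCoord_add (mem_chart_source E _)]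
  abel

theorem pullbackCov_smul (z : M) (r : ℝ) (v : TangentSpace 𝓘(ℝ, ℂ) z) :
    pullbackCov A J φ ξ z (r • v) = r • pullbackCov A J φ ξ z v := by
  change ofCoord (φ z) (mvfderiv 𝓘(ℝ, ℂ) _ z (r • v)) (φ z) + covAJConn A J _ _ _ =
    r • (ofCoord (φ z) (mvfderiv 𝓘(ℝ, ℂ) _ z v) (φ z) + covAJConn A J _ _ _)
  rw [map_smul, map_smul, map_smul, ofCoord_smul (mem_chart_source E _), smul_add]

theorem pullbackCov01_add (z : M) (v w : TangentSpace 𝓘(ℝ, ℂ) z) :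
    pullbackCov01 A J φ ξ z (v + w) = pullbackCov01 A J φ ξ z v + pullbackCov01 A J φ ξ z w := by
  simp only [pullbackCov01, map_add, pullbackCov_add]
  module

theorem pullbackCov01_cmul (z : M) (c : ℂ) (v : TangentSpace 𝓘(ℝ, ℂ) z) :
    pullbackCov01 A J φ ξ z (cmul c v)
      = complexSMul J (φ z) (starRingEnd ℂ c) (pullbackCov01 A J φ ξ z v) := by
  have hn : ∀ w, pullbackCov A J φ ξ z (-w) = -pullbackCov A J φ ξ z w := fun w => by
    simpa using pullbackCov_smul A J φ ξ z (-1) w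
  rw [cmul_eq c v]
  simp only [pullbackCov01, complexSMul, map_add, map_smul, cmul_I_cmul_I, pullbackCov_add,
    pullbackCov_smul, hn, map_neg, J.apply_apply, Complex.conj_re, Complex.conj_im]
  module

variable {φ ξ}

/-- The Leibniz rule for the `(0,1)`-part of the covariant derivative. -/
theorem pullbackCov01_complexSMul [T2Space X] [FiniteDimensional ℝ E]
    (hφ : ContMDiff 𝓘(ℝ, ℂ) 𝓘(ℝ, E) ∞ φ) {U : Set M}
    (hU : IsOpen U) (hξ : IsSmoothAlong φ ξ U) {z : M} (hz : z ∈ U) {g : M → ℂ}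
    (hg : MDifferentiableAt 𝓘(ℝ, ℂ) 𝓘(ℝ, ℂ) g z)
    {ξ' : ∀ z, TangentSpace 𝓘(ℝ, E) (φ z)}
    (hξ' : ∀ᶠ z' in 𝓝 z, ξ' z' = complexSMul J (φ z') (g z') (ξ z'))
    (v : TangentSpace 𝓘(ℝ, ℂ) z) :
    pullbackCov01 A J φ ξ' z v
      = complexSMul J (φ z) (dbarFun g z v) (ξ z)
        + complexSMul J (φ z) (g z) (pullbackCov01 A J φ ξ z v) := by
  simp only [pullbackCov01, pullbackCov_complexSMul A J hφ hU hξ hz hg hξ']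
  have h2 : (2⁻¹ : ℂ).re = 1 / 2 ∧ (2⁻¹ : ℂ).im = 0 := by
    have : (2⁻¹ : ℂ) = ((1 / 2 : ℝ) : ℂ) := by push_cast; norm_num
    rw [this]
    exact ⟨Complex.ofReal_re _, Complex.ofReal_im _⟩
  simp only [dbarFun, complexSMul, map_add, map_smul, J.apply_apply, Complex.mul_re,
    Complex.mul_im, Complex.add_re, Complex.add_im, Complex.I_re, Complex.I_im, one_div, h2]
  module

/-- The pulled back connection is natural with respect to maps of the source. -/
theorem pullbackCov_comp {m : M → M} {z : M} (hm : MDifferentiableAt 𝓘(ℝ, ℂ) 𝓘(ℝ, ℂ) m z)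
    {U : Set M} (hU : IsOpen U) (hz : m z ∈ U) (hξ : IsSmoothAlong φ ξ U)
    (v : TangentSpace 𝓘(ℝ, ℂ) z) :
    pullbackCov A J (φ ∘ m) (fun y => ξ (m y)) z v
      = pullbackCov A J φ ξ (m z) (mfderiv 𝓘(ℝ, ℂ) 𝓘(ℝ, ℂ) m z v) := by
  have h1 := (hξ.contMDiffAt (hU.mem_nhds hz)).mdifferentiableAt (by simp)
  have h2 := (mdifferentiableAt_totalSpace 𝓘(ℝ, E) _).1 h1
  have h3 := mvfderiv_comp_map h2.2 hm v
  have h4 := mfderiv_comp_apply z h2.1 hm v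
  change ofCoord (φ (m z)) (mvfderiv 𝓘(ℝ, ℂ) (fun y =>
      (trivializationAt E (TangentSpace 𝓘(ℝ, E)) (φ (m z)) ⟨φ (m y), ξ (m y)⟩).2) z v) (φ (m z))
    + covAJ A J (constField (φ (m z)) (ξ (m z))) (φ (m z))
      (mfderiv 𝓘(ℝ, ℂ) 𝓘(ℝ, E) (φ ∘ m) z v) = _
  rw [h3, h4]
  rfl

end Directions

/-! ### Holomorphic maps as real maps -/

section Holomorphic

variable {N : Type*} [TopologicalSpace N] [ChartedSpace ℂ N]
  {N' : Type*} [TopologicalSpace N'] [ChartedSpace ℂ N']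

theorem hasMFDerivAt_real_of_complex {f : N → N'} {z : N} {f' : ℂ →L[ℂ] ℂ}
    (hf : HasMFDerivAt 𝓘(ℂ, ℂ) 𝓘(ℂ, ℂ) f z f') :
    HasMFDerivAt 𝓘(ℝ, ℂ) 𝓘(ℝ, ℂ) f z (f'.restrictScalars ℝ) :=
  ⟨hf.1, HasFDerivWithinAt.restrictScalars ℝ hf.2⟩

/-- A real differentiable map of Riemann surfaces is holomorphic if its differential is complex
linear. -/
theorem hasMFDerivAt_complex_of_real {f : N → N'} {z : N} {f' : ℂ →L[ℝ] ℂ}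
    (hf : HasMFDerivAt 𝓘(ℝ, ℂ) 𝓘(ℝ, ℂ) f z f') {g' : ℂ →L[ℂ] ℂ}
    (hg : g'.restrictScalars ℝ = f') :
    HasMFDerivAt 𝓘(ℂ, ℂ) 𝓘(ℂ, ℂ) f z g' :=
  ⟨hf.1, HasFDerivWithinAt.of_restrictScalars ℝ hf.2 hg⟩

theorem mdifferentiableAt_real_of_complex {f : N → N'} {z : N}
    (hf : MDifferentiableAt 𝓘(ℂ, ℂ) 𝓘(ℂ, ℂ) f z) : MDifferentiableAt 𝓘(ℝ, ℂ) 𝓘(ℝ, ℂ) f z :=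
  (hasMFDerivAt_real_of_complex hf.hasMFDerivAt).mdifferentiableAt

theorem mfderiv_real_eq_complex {f : N → N'} {z : N}
    (hf : MDifferentiableAt 𝓘(ℂ, ℂ) 𝓘(ℂ, ℂ) f z) (v : ℂ) :
    mfderiv 𝓘(ℝ, ℂ) 𝓘(ℝ, ℂ) f z v = mfderiv 𝓘(ℂ, ℂ) 𝓘(ℂ, ℂ) f z v := by
  rw [(hasMFDerivAt_real_of_complex hf.hasMFDerivAt).mfderiv]
  rfl

/-- Holomorphic maps of Riemann surfaces are analytic. -/
theorem contMDiffAt_of_eventually_mdifferentiableAt [IsManifold 𝓘(ℂ, ℂ) ω N]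
    [IsManifold 𝓘(ℂ, ℂ) ω N'] {f : N → N'} {z : N} {n : WithTop ℕ∞}
    (hf : ∀ᶠ y in 𝓝 z, MDifferentiableAt 𝓘(ℂ, ℂ) 𝓘(ℂ, ℂ) f y) :
    ContMDiffAt 𝓘(ℂ, ℂ) 𝓘(ℂ, ℂ) n f z := by
  have : IsManifold 𝓘(ℂ, ℂ) 1 N := .of_le (n := ω) le_top
  have : IsManifold 𝓘(ℂ, ℂ) 1 N' := .of_le (n := ω) le_top
  have hz := hf.self_of_nhds
  rw [contMDiffAt_iff]
  refine ⟨hz.continuousAt, ?_⟩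
  have h1 : ∀ᶠ y in 𝓝 z, MDifferentiableAt 𝓘(ℂ, ℂ) 𝓘(ℂ, ℂ) f y ∧
      f y ∈ (chartAt ℂ (f z)).source :=
    hf.and (hz.continuousAt.preimage_mem_nhds
      ((chartAt ℂ (f z)).open_source.mem_nhds (mem_chart_source ℂ _)))
  have h2 : ∀ᶠ w in 𝓝 (chartAt ℂ z z), w ∈ (chartAt ℂ z).target ∧
      MDifferentiableAt 𝓘(ℂ, ℂ) 𝓘(ℂ, ℂ) f ((chartAt ℂ z).symm w) ∧
      f ((chartAt ℂ z).symm w) ∈ (chartAt ℂ (f z)).source := by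
    refine Filter.Eventually.and ((chartAt ℂ z).open_target.mem_nhds (mem_chart_target ℂ z)) ?_
    have h3 := (chartAt ℂ z).continuousAt_symm (mem_chart_target ℂ z)
    rw [ContinuousAt, (chartAt ℂ z).left_inv (mem_chart_source ℂ z)] at h3
    exact h3.eventually h1
  obtain ⟨B, hB, hBo, hB₀⟩ := eventually_nhds_iff.1 h2
  have h4 : DifferentiableOn ℂ (chartAt ℂ (f z) ∘ f ∘ (chartAt ℂ z).symm) B := by
    intro w hw
    obtain ⟨hw1, hw2, hw3⟩ := hB w hw
    have h5 := (mdifferentiableAt_atlas_symm (I := 𝓘(ℂ, ℂ)) (chart_mem_atlas ℂ z) hw1)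
    have h6 := (mdifferentiableAt_atlas (I := 𝓘(ℂ, ℂ)) (chart_mem_atlas ℂ (f z)) hw3)
    exact (h6.comp w (hw2.comp w h5)).differentiableAt.differentiableWithinAt
  exact ((h4.contDiffOn hBo).contDiffAt (hBo.mem_nhds hB₀)).contDiffWithinAt

theorem contMDiffAt_real_of_complex {f : N → N'} {z : N} {n : WithTop ℕ∞}
    (hf : ContMDiffAt 𝓘(ℂ, ℂ) 𝓘(ℂ, ℂ) n f z) : ContMDiffAt 𝓘(ℝ, ℂ) 𝓘(ℝ, ℂ) n f z := by
  rw [contMDiffAt_iff] at hf ⊢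
  exact ⟨hf.1, hf.2.restrict_scalars ℝ⟩

theorem contMDiffOn_real_of_mdifferentiableOn [IsManifold 𝓘(ℂ, ℂ) ω N]
    [IsManifold 𝓘(ℂ, ℂ) ω N'] {f : N → N'} {U : Set N} (hU : IsOpen U)
    (hf : MDifferentiableOn 𝓘(ℂ, ℂ) 𝓘(ℂ, ℂ) f U) : ContMDiffOn 𝓘(ℝ, ℂ) 𝓘(ℝ, ℂ) ∞ f U :=
  fun _ hz => (contMDiffAt_real_of_complex (contMDiffAt_of_eventually_mdifferentiableAt
    (Filter.eventually_of_mem (hU.mem_nhds hz)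
      fun _ hy => hf.mdifferentiableAt (hU.mem_nhds hy)))).contMDiffWithinAt

/-- Holomorphic functions are annihilated by the Cauchy-Riemann operator. -/
theorem dbarFun_eq_zero {f : N → ℂ} {z : N} (hf : MDifferentiableAt 𝓘(ℂ, ℂ) 𝓘(ℂ, ℂ) f z)
    (v : TangentSpace 𝓘(ℝ, ℂ) z) : dbarFun f z v = 0 := by
  have h1 : ∀ w : ℂ, (mvfderiv 𝓘(ℝ, ℂ) f z w : ℂ) = mfderiv 𝓘(ℂ, ℂ) 𝓘(ℂ, ℂ) f z w :=
    mfderiv_real_eq_complex hf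
  have h2 : (mvfderiv 𝓘(ℝ, ℂ) f z (cmul Complex.I v) : ℂ)
      = Complex.I * mvfderiv 𝓘(ℝ, ℂ) f z v := by
    rw [h1 v]
    refine (h1 _).trans ?_
    exact (mfderiv 𝓘(ℂ, ℂ) 𝓘(ℂ, ℂ) f z).map_smul Complex.I (show ℂ from v)
  unfold dbarFun
  rw [h2, ← mul_assoc, Complex.I_mul_I]
  ring

/-- A continuous square root of a nonvanishing holomorphic function is holomorphic. -/
theorem mdifferentiableAt_of_sq {g : N → ℂ} {z : N} (hg : ContinuousAt g z) (h0 : g z ≠ 0)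
    (h : MDifferentiableAt 𝓘(ℂ, ℂ) 𝓘(ℂ, ℂ) (fun y => g y ^ 2) z) :
    MDifferentiableAt 𝓘(ℂ, ℂ) 𝓘(ℂ, ℂ) g z := by
  -- near `z` the quotient `g y / g z` has positive real part, hence is the principal root
  have h1 : ∀ᶠ y in 𝓝 z, 0 < (g y / g z).re := by
    have h2 : ContinuousAt (fun y => (g y / g z).re) z :=
      Complex.continuous_re.continuousAt.comp (hg.div_const _)
    refine h2.eventually (lt_mem_nhds ?_)
    simp [div_self h0]
  have h3 : DifferentiableAt ℂ (fun w : ℂ => g z * (w / g z ^ 2) ^ (1 / 2 : ℂ)) (g z ^ 2) := by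
    refine DifferentiableAt.const_mul (DifferentiableAt.cpow_const
      (differentiableAt_id.div_const _) ?_) _
    simp [div_self (pow_ne_zero 2 h0)]
  have h4 : MDifferentiableAt 𝓘(ℂ, ℂ) 𝓘(ℂ, ℂ)
      (fun y => g z * (g y ^ 2 / g z ^ 2) ^ (1 / 2 : ℂ)) z :=
    DifferentiableAt.comp_mdifferentiableAt (g := fun w : ℂ => g z * (w / g z ^ 2) ^ (1 / 2 : ℂ))
      (f := fun y => g y ^ 2) h3 h
  refine h4.congr_of_eventuallyEq ?_
  filter_upwards [h1] with y hy
  have h5 : ((g y / g z) ^ 2) ^ (1 / 2 : ℂ) = g y / g z := by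
    have h6 := Complex.pow_cpow_nat_inv (x := g y / g z) (n := 2) two_ne_zero
      (by have := Complex.abs_arg_lt_pi_div_two_iff.2 (Or.inl hy)
          rw [abs_lt] at this; push_cast; exact this.1)
      (by have := Complex.abs_arg_lt_pi_div_two_iff.2 (Or.inl hy)
          rw [abs_lt] at this; push_cast; exact this.2.le)
    simpa using h6
  rw [← div_pow, h5]
  field_simp

theorem mdifferentiableAt_zpow {g : N → ℂ} {z : N} (d : ℤ) (h0 : g z ≠ 0)
    (h : MDifferentiableAt 𝓘(ℂ, ℂ) 𝓘(ℂ, ℂ) g z) :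
    MDifferentiableAt 𝓘(ℂ, ℂ) 𝓘(ℂ, ℂ) (fun y => g y ^ d) z :=
  DifferentiableAt.comp_mdifferentiableAt (g := fun w : ℂ => w ^ d)
    (differentiableAt_zpow.2 (Or.inl h0)) h

theorem contMDiffAt_complex_mul {f g : N → ℂ} {z : N}
    (hf : ContMDiffAt 𝓘(ℝ, ℂ) 𝓘(ℝ, ℂ) ∞ f z) (hg : ContMDiffAt 𝓘(ℝ, ℂ) 𝓘(ℝ, ℂ) ∞ g z) :
    ContMDiffAt 𝓘(ℝ, ℂ) 𝓘(ℝ, ℂ) ∞ (fun y => f y * g y) z :=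
  ContDiffAt.comp_contMDiffAt (g := fun p : ℂ × ℂ => p.1 * p.2) (f := fun y => (f y, g y))
    (contDiff_fst.mul contDiff_snd).contDiffAt (hf.prodMk_space hg)

theorem contMDiffAt_complex_div {f g : N → ℂ} {z : N}
    (hf : ContMDiffAt 𝓘(ℝ, ℂ) 𝓘(ℝ, ℂ) ∞ f z) (hg : ContMDiffAt 𝓘(ℝ, ℂ) 𝓘(ℝ, ℂ) ∞ g z)
    (h0 : g z ≠ 0) : ContMDiffAt 𝓘(ℝ, ℂ) 𝓘(ℝ, ℂ) ∞ (fun y => f y / g y) z :=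
  contMDiffAt_complex_mul hf (ContDiffAt.comp_contMDiffAt (g := fun w : ℂ => w⁻¹)
    (contDiffAt_inv ℝ h0) hg)

end Holomorphic

namespace SpinStructure

variable {M : Type*} [TopologicalSpace M] [ChartedSpace ℂ M] [IsManifold 𝓘(ℂ, ℂ) ω M]
  {h : SurfaceMetric M} {P : Type*} [TopologicalSpace P] [MulAction Circle P]
  (S : SpinStructure h P)

/-! ### Fibres of the line bundles `L_d` -/

section Fibre

variable {d : ℤ} {z : M}

theorem ratio_smul_self {b : S.L d z} (hb : b ≠ 0) (a : S.L d z) : S.ratio b a • b = a := by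
  have h1 : b.1 (S.point z) ≠ 0 := fun h0 => hb ((S.coord_eq_zero_iff b _).1 h0)
  rw [← sub_eq_zero]
  refine (S.coord_eq_zero_iff _ (S.point z)).1 ?_
  change a.1 (S.point z) / b.1 (S.point z) * b.1 (S.point z) - a.1 (S.point z) = 0
  rw [div_mul_cancel₀ _ h1, sub_self]

theorem ratio_self {b : S.L d z} (hb : b ≠ 0) : S.ratio b b = 1 :=
  div_self fun h0 => hb ((S.coord_eq_zero_iff b _).1 h0)

theorem ratio_eq_of_eq_smul {b : S.L d z} (hb : b ≠ 0) {a : S.L d z} {c : ℂ} (ha : a = c • b) :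
    S.ratio b a = c := by
  rw [ha, map_smul, S.ratio_self hb, smul_eq_mul, mul_one]

theorem ratio_ne_zero {a b : S.L d z} (ha : a ≠ 0) (hb : b ≠ 0) : S.ratio b a ≠ 0 := fun h0 =>
  ha (by rw [← S.ratio_smul_self hb a, h0, zero_smul])

theorem ratio_eq_div {b : S.L d z} (hb : b ≠ 0) (a : S.L d z) (p : S.Fib z) :
    S.ratio b a = a.1 p / b.1 p := by
  have h1 : b.1 p ≠ 0 := fun h0 => hb ((S.coord_eq_zero_iff b _).1 h0)
  rw [eq_div_iff h1]
  exact congrFun (congrArg Subtype.val (S.ratio_smul_self hb a)) p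

theorem ratio_mul_ratio {b : S.L d z} (hb : b ≠ 0) (a c : S.L d z) :
    S.ratio b a * S.ratio c b = S.ratio c a := by
  conv_rhs => rw [← S.ratio_smul_self hb a, map_smul, smul_eq_mul]

theorem ratio_pow (a b : S.L 1 z) : S.ratio (S.pow d b) (S.pow d a) = S.ratio b a ^ d :=
  (div_zpow _ _ d).symm

theorem pow_ne_zero {a : S.L 1 z} (ha : a ≠ 0) : S.pow d a ≠ 0 := fun h0 => by
  have h1 : a.1 (S.point z) ^ d = 0 := congrFun (congrArg Subtype.val h0) (S.point z)
  exact ha ((S.coord_eq_zero_iff a _).1 (eq_zero_of_zpow_eq_zero h1))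

theorem sq_smul (c : ℂ) (a : S.L 1 z) : S.sq (c • a) = cmul (c ^ 2) (S.sq a) := by
  unfold sq
  rw [cmul_cmul, ← mul_pow]
  rfl

theorem frameVec_ne_zero (p : S.Fib z) : S.frameVec p ≠ 0 := by
  obtain ⟨p, rfl⟩ := p
  intro h0
  have h1 := S.frame_unit p
  have h2 : (S.frame p).2 = 0 := h0
  rw [h2] at h1
  simp at h1

theorem sq_ne_zero {a : S.L 1 z} (ha : a ≠ 0) : S.sq a ≠ 0 := by
  intro h0
  rcases mul_eq_zero (M₀ := ℂ).1 h0 with h1 | h1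
  · exact ha ((S.coord_eq_zero_iff a _).1 (pow_eq_zero_iff two_ne_zero |>.1 h1))
  · exact S.frameVec_ne_zero _ h1

end Fibre

/-! ### Holomorphic and smooth frames -/

section Frames

variable {d : ℤ}

/-- The quotient of two continuous sections is continuous. -/
theorem continuousOn_ratio {a b : ∀ z, S.L d z} {U : Set M} (hU : IsOpen U)
    (ha : S.IsContSection a U) (hb : S.IsContSection b U) (hb0 : ∀ z ∈ U, b z ≠ 0) :
    ContinuousOn (fun z => S.ratio (b z) (a z)) U := by
  intro z hz
  obtain ⟨t, hzt, -⟩ := S.exists_trivialization z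
  -- a local section of the spin bundle near `z`
  let σ : M → P := fun y => t.toOpenPartialHomeomorph.symm (y, 1)
  have hσp : ∀ y ∈ t.baseSet, S.proj (σ y) = y := fun y hy => t.proj_symm_apply' hy
  have hσc : ContinuousOn σ t.baseSet := t.continuousOn_symm_prodMk_left
  have hW : U ∩ t.baseSet ∈ 𝓝 z := (hU.inter t.open_baseSet).mem_nhds ⟨hz, hzt⟩
  have hmaps : Set.MapsTo σ (U ∩ t.baseSet) (S.proj ⁻¹' U) := fun y hy => by
    change S.proj (σ y) ∈ U
    rw [hσp y hy.2]
    exact hy.1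
  have hc : ∀ {c : ∀ z, S.L d z}, S.IsContSection c U →
      ContinuousOn (fun y => S.coord c (σ y)) (U ∩ t.baseSet) := fun hc =>
    hc.comp (hσc.mono Set.inter_subset_right) hmaps
  have hcoord : ∀ (c : ∀ z, S.L d z) (y : M) (hy : S.proj (σ y) = y),
      S.coord c (σ y) = (c y).1 ⟨σ y, hy⟩ := by
    intro c y hy
    have h1 : ∀ (w : M) (hw : S.proj (σ y) = w), S.coord c (σ y) = (c w).1 ⟨σ y, hw⟩ := by
      rintro w rfl
      rfl
    exact h1 y hy
  have h1 : ContinuousOn (fun y => S.coord a (σ y) / S.coord b (σ y)) (U ∩ t.baseSet) := by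
    refine (hc ha).div (hc hb) fun y hy h0 => hb0 y hy.1 ?_
    rw [hcoord b y (hσp y hy.2)] at h0
    exact (S.coord_eq_zero_iff _ _).1 h0
  refine ((h1.congr fun y hy => ?_).continuousAt hW).continuousWithinAt
  rw [S.ratio_eq_div (hb0 y hy.1) (a y) ⟨σ y, hσp y hy.2⟩, hcoord a y (hσp y hy.2),
    hcoord b y (hσp y hy.2)]

/-- Two holomorphic square roots differ by a holomorphic function: its square is the quotient of
two holomorphic vector fields, and it is continuous. -/
theorem IsHolRoot.mdifferentiableAt_ratio {a b : ∀ z, S.L 1 z} {U U' : Set M}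
    (ha : S.IsHolRoot a U) (hb : S.IsHolRoot b U') {z : M} (hz : z ∈ U) (hz' : z ∈ U') :
    MDifferentiableAt 𝓘(ℂ, ℂ) 𝓘(ℂ, ℂ) (fun y => S.ratio (b y) (a y)) z := by
  obtain ⟨hUo, hac, ha0, hav⟩ := ha
  obtain ⟨hUo', hbc, hb0, hbv⟩ := hb
  have hW : IsOpen (U ∩ U') := hUo.inter hUo'
  have hWz := hW.mem_nhds ⟨hz, hz'⟩
  have hcont := (S.continuousOn_ratio hW (hac.mono fun p hp => hp.1) (hbc.mono fun p hp => hp.2)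
    fun y hy => hb0 y hy.2).continuousAt hWz
  refine mdifferentiableAt_of_sq hcont (S.ratio_ne_zero (ha0 z hz) (hb0 z hz')) ?_
  let τ := trivializationAt ℂ (TangentSpace 𝓘(ℂ, ℂ) : M → Type _) z
  have hcoord : ∀ {V : ∀ y : M, TangentSpace 𝓘(ℝ, ℂ) y} {W : Set M}, IsOpen W → z ∈ W →
      IsHolVectorField V W → MDifferentiableAt 𝓘(ℂ, ℂ) 𝓘(ℂ, ℂ) (fun y => (τ ⟨y, V y⟩).2) z :=
    fun hWo hzW hV => ((mdifferentiableAt_totalSpace 𝓘(ℂ, ℂ) _).1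
      (MDifferentiableOn.mdifferentiableAt hV (hWo.mem_nhds hzW))).2
  have hlin : ∀ {y : M} (_ : y ∈ (chartAt ℂ z).source), IsLinearMap ℂ
      (fun v : TangentSpace 𝓘(ℂ, ℂ) y => (τ ⟨y, v⟩).2) := fun hy => τ.linear ℂ hy
  have hne : (τ ⟨z, S.sq (b z)⟩).2 ≠ 0 := by
    intro h0
    have h1 := τ.symm_apply_apply_mk (mem_chart_source ℂ z) (S.sq (b z))
    have h2 := τ.symm_apply_apply_mk (mem_chart_source ℂ z) (0 : TangentSpace 𝓘(ℂ, ℂ) z)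
    rw [(hlin (mem_chart_source ℂ z)).map_zero] at h2
    rw [h0, h2] at h1
    exact S.sq_ne_zero (hb0 z hz') h1.symm
  have hbd := hcoord hUo' hz' hbv
  refine ((hcoord hUo hz hav).div hbd hne).congr_of_eventuallyEq ?_
  have hne' : ∀ᶠ y in 𝓝 z, (τ ⟨y, S.sq (b y)⟩).2 ≠ 0 := hbd.continuousAt.eventually_ne hne
  filter_upwards [hWz, (chartAt ℂ z).open_source.mem_nhds (mem_chart_source ℂ z), hne']
    with y hy hys hy0
  have h1 : S.sq (a y) = cmul (S.ratio (b y) (a y) ^ 2) (S.sq (b y)) := by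
    rw [← S.sq_smul, S.ratio_smul_self (hb0 y hy.2)]
  have h2 : (τ ⟨y, S.sq (a y)⟩).2 = S.ratio (b y) (a y) ^ 2 * (τ ⟨y, S.sq (b y)⟩).2 := by
    rw [h1]
    exact (hlin hys).map_smul _ _
  change _ = (τ ⟨y, S.sq (a y)⟩).2 / (τ ⟨y, S.sq (b y)⟩).2
  rw [h2, mul_div_cancel_right₀ _ hy0]

variable {S} {e e' : ∀ z, S.L d z} {W W' : Set M}

theorem IsHolFrame.isOpen (he : S.IsHolFrame e W) : IsOpen W := by
  obtain ⟨a, ha, -⟩ := he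
  exact ha.1

theorem IsHolFrame.ne_zero (he : S.IsHolFrame e W) {z : M} (hz : z ∈ W) : e z ≠ 0 := by
  obtain ⟨a, ha, hea⟩ := he
  rw [hea z hz]
  exact S.pow_ne_zero (ha.2.2.1 z hz)

/-- The transition functions between local holomorphic frames of `L_d` are holomorphic. -/
theorem IsHolFrame.mdifferentiableAt_ratio (he : S.IsHolFrame e W) (he' : S.IsHolFrame e' W')
    {z : M} (hz : z ∈ W) (hz' : z ∈ W') :
    MDifferentiableAt 𝓘(ℂ, ℂ) 𝓘(ℂ, ℂ) (fun y => S.ratio (e' y) (e y)) z := by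
  have hWz := (he.isOpen.inter he'.isOpen).mem_nhds ⟨hz, hz'⟩
  obtain ⟨a, ha, hea⟩ := he
  obtain ⟨b, hb, heb⟩ := he'
  refine (mdifferentiableAt_zpow (g := fun y => S.ratio (b y) (a y)) d
    (S.ratio_ne_zero (ha.2.2.1 z hz) (hb.2.2.1 z hz'))
    (ha.mdifferentiableAt_ratio S hb hz hz')).congr_of_eventuallyEq ?_
  filter_upwards [hWz] with y hy
  rw [hea y hy.1, heb y hy.2, S.ratio_pow]

theorem IsHolFrame.contMDiffOn_ratio (he : S.IsHolFrame e W) (he' : S.IsHolFrame e' W') :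
    ContMDiffOn 𝓘(ℝ, ℂ) 𝓘(ℝ, ℂ) ∞ (fun y => S.ratio (e' y) (e y)) (W ∩ W') :=
  contMDiffOn_real_of_mdifferentiableOn (he.isOpen.inter he'.isOpen) fun _ hz =>
    (he.mdifferentiableAt_ratio he' hz.1 hz.2).mdifferentiableWithinAt

variable {θ θ' : ∀ z, S.L d z} {U U' : Set M}

theorem IsSmoothSection.contMDiffOn_ratio (hU : IsOpen U) (hθ : S.IsSmoothSection θ U)
    (he : S.IsHolFrame e W) :
    ContMDiffOn 𝓘(ℝ, ℂ) 𝓘(ℝ, ℂ) ∞ (fun y => S.ratio (e y) (θ y)) (U ∩ W) := by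
  intro z hz
  obtain ⟨e', W', hzW', he', hsm⟩ := hθ z hz.1
  have h1 := contMDiffAt_complex_mul
    (hsm.contMDiffAt ((hU.inter he'.isOpen).mem_nhds ⟨hz.1, hzW'⟩))
    ((he'.contMDiffOn_ratio he).contMDiffAt
      ((he'.isOpen.inter he.isOpen).mem_nhds ⟨hzW', hz.2⟩))
  refine (h1.congr_of_eventuallyEq ?_).contMDiffWithinAt
  filter_upwards [he'.isOpen.mem_nhds hzW'] with y hy
  exact (S.ratio_mul_ratio (he'.ne_zero hy) _ _).symm

theorem IsSmoothFrame.contMDiffOn_ratio (hθ : S.IsSmoothFrame θ U) (hθ' : S.IsSmoothFrame θ' U') :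
    ContMDiffOn 𝓘(ℝ, ℂ) 𝓘(ℝ, ℂ) ∞ (fun y => S.ratio (θ' y) (θ y)) (U ∩ U') := by
  intro z hz
  obtain ⟨e, W, hzW, he, hsm⟩ := hθ.2.1 z hz.1
  have h1 := hsm.contMDiffAt ((hθ.1.inter he.isOpen).mem_nhds ⟨hz.1, hzW⟩)
  have h2 := (hθ'.2.1.contMDiffOn_ratio hθ'.1 he).contMDiffAt
    ((hθ'.1.inter he.isOpen).mem_nhds ⟨hz.2, hzW⟩)
  have h3 := contMDiffAt_complex_div h1 h2 (S.ratio_ne_zero (hθ'.2.2 z hz.2) (he.ne_zero hzW))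
  refine (h3.congr_of_eventuallyEq ?_).contMDiffWithinAt
  filter_upwards [hθ'.1.mem_nhds hz.2, he.isOpen.mem_nhds hzW] with y hy hyW
  rw [eq_div_iff (S.ratio_ne_zero (hθ'.2.2 y hy) (he.ne_zero hyW))]
  exact S.ratio_mul_ratio (hθ'.2.2 y hy) _ _

theorem IsHolFrame.isSmoothFrame (he : S.IsHolFrame e W) : S.IsSmoothFrame e W := by
  refine ⟨he.isOpen, fun z hz => ⟨e, W, hz, he, ?_⟩, fun z hz => he.ne_zero hz⟩
  exact he.contMDiffOn_ratio he

/-! ### The Dolbeault operator of `L_d` -/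

/-- The Dolbeault operator can be computed with an arbitrary local holomorphic frame. -/
theorem dbarL_eq (he : S.IsHolFrame e W) {z : M} (hz : z ∈ W)
    (hθ : MDifferentiableAt 𝓘(ℝ, ℂ) 𝓘(ℝ, ℂ) (fun y => S.ratio (e y) (θ y)) z)
    (v : TangentSpace 𝓘(ℝ, ℂ) z) :
    S.dbarL θ z v = dbarFun (fun y => S.ratio (e y) (θ y)) z v • e z := by
  obtain ⟨W₀, hz₀, he₀⟩ : ∃ W₀ : Set M, z ∈ W₀ ∧ S.IsHolFrame (S.holFrameAt d z) W₀ :=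
    (S.exists_holFrame d z).choose_spec
  have h1 := he.mdifferentiableAt_ratio he₀ hz hz₀
  have h2 : (fun y => S.ratio (S.holFrameAt d z y) (θ y)) =ᶠ[𝓝 z]
      fun y => S.ratio (e y) (θ y) * S.ratio (S.holFrameAt d z y) (e y) := by
    filter_upwards [he.isOpen.mem_nhds hz] with y hy
    exact (S.ratio_mul_ratio (he.ne_zero hy) _ _).symm
  unfold dbarL
  rw [dbarFun_congr h2, dbarFun_mul hθ (mdifferentiableAt_real_of_complex h1),
    dbarFun_eq_zero h1, mul_zero, zero_add, mul_smul, S.ratio_smul_self (he₀.ne_zero hz₀)]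

theorem IsSmoothFrame.mdifferentiableAt_ratio (hθ : S.IsSmoothFrame θ U)
    (hθ' : S.IsSmoothFrame θ' U') {z : M} (hz : z ∈ U) (hz' : z ∈ U') :
    MDifferentiableAt 𝓘(ℝ, ℂ) 𝓘(ℝ, ℂ) (fun y => S.ratio (θ' y) (θ y)) z :=
  ((hθ.contMDiffOn_ratio hθ').contMDiffAt
    ((hθ.1.inter hθ'.1).mem_nhds ⟨hz, hz'⟩)).mdifferentiableAt (by simp)

/-- The Leibniz rule for the Dolbeault operator, for the section `θ' = (θ' / θ) • θ`. -/
theorem dbarL_eq_ratio (hθ : S.IsSmoothFrame θ U) (hθ' : S.IsSmoothFrame θ' U') {z : M}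
    (hz : z ∈ U) (hz' : z ∈ U') (v : TangentSpace 𝓘(ℝ, ℂ) z) :
    S.dbarL θ' z v = dbarFun (fun y => S.ratio (θ y) (θ' y)) z v • θ z
      + S.ratio (θ z) (θ' z) • S.dbarL θ z v := by
  obtain ⟨e, W, hzW, he⟩ := S.exists_holFrame d z
  have h1 := hθ.mdifferentiableAt_ratio he.isSmoothFrame hz hzW
  have h2 := hθ'.mdifferentiableAt_ratio he.isSmoothFrame hz' hzW
  have h3 := hθ'.mdifferentiableAt_ratio hθ hz' hz
  have h4 : (fun y => S.ratio (e y) (θ' y)) =ᶠ[𝓝 z]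
      fun y => S.ratio (θ y) (θ' y) * S.ratio (e y) (θ y) := by
    filter_upwards [hθ.1.mem_nhds hz] with y hy
    exact (S.ratio_mul_ratio (hθ.2.2 y hy) _ _).symm
  rw [dbarL_eq he hzW h1, dbarL_eq he hzW h2, dbarFun_congr h4, dbarFun_mul h3 h1, add_smul,
    mul_smul, mul_smul, S.ratio_smul_self (he.ne_zero hzW), add_comm]

end Frames

end SpinStructure

/-! ### Lifts of a conformal automorphism to the line bundles -/

section Automorphism

variable {M : Type*} [TopologicalSpace M] [ChartedSpace ℂ M]

/-- The differential of `m` is complex linear. -/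
def IsComplexLinear (m : M ≃ₘ^∞⟮𝓘(ℝ, ℂ), 𝓘(ℝ, ℂ)⟯ M) : Prop :=
  ∀ (z : M) (c : ℂ) (v : TangentSpace 𝓘(ℝ, ℂ) z),
    mfderiv 𝓘(ℝ, ℂ) 𝓘(ℝ, ℂ) m z (cmul c v) = cmul c (mfderiv 𝓘(ℝ, ℂ) 𝓘(ℝ, ℂ) m z v)

variable {m : M ≃ₘ^∞⟮𝓘(ℝ, ℂ), 𝓘(ℝ, ℂ)⟯ M}

theorem mdifferentiableAt_diffeo (z : M) : MDifferentiableAt 𝓘(ℝ, ℂ) 𝓘(ℝ, ℂ) m z :=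
  (m.contMDiff z).mdifferentiableAt (by simp)

theorem tangentMap_symm_tangentMap (p : TangentBundle 𝓘(ℝ, ℂ) M) :
    tangentMap 𝓘(ℝ, ℂ) 𝓘(ℝ, ℂ) m.symm (tangentMap 𝓘(ℝ, ℂ) 𝓘(ℝ, ℂ) m p) = p := by
  rw [← tangentMap_comp_at p (mdifferentiableAt_diffeo _) (mdifferentiableAt_diffeo _)]
  have h1 : (m.symm : M → M) ∘ m = id := funext m.symm_apply_apply
  rw [h1, tangentMap_id, id]

theorem mfderiv_diffeo_injective (z : M) :
    Function.Injective (mfderiv 𝓘(ℝ, ℂ) 𝓘(ℝ, ℂ) m z) := by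
  intro v w hvw
  have h1 := tangentMap_symm_tangentMap (m := m) ⟨z, v⟩
  have h2 := tangentMap_symm_tangentMap (m := m) ⟨z, w⟩
  have h3 : tangentMap 𝓘(ℝ, ℂ) 𝓘(ℝ, ℂ) m ⟨z, v⟩ = tangentMap 𝓘(ℝ, ℂ) 𝓘(ℝ, ℂ) m ⟨z, w⟩ :=
    congrArg (Bundle.TotalSpace.mk (m z)) hvw
  rw [h3, h2] at h1
  exact (eq_of_heq (Bundle.TotalSpace.mk.inj h1).2).symm

theorem mfderiv_diffeo_surjective (z : M) :
    Function.Surjective (mfderiv 𝓘(ℝ, ℂ) 𝓘(ℝ, ℂ) m z) := by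
  let f' : ℂ →L[ℝ] ℂ := mfderiv 𝓘(ℝ, ℂ) 𝓘(ℝ, ℂ) m z
  exact LinearMap.surjective_of_injective (f := f'.toLinearMap) (mfderiv_diffeo_injective z)

theorem IsComplexLinear.mdifferentiable (hm : IsComplexLinear m) :
    MDifferentiable 𝓘(ℂ, ℂ) 𝓘(ℂ, ℂ) m := by
  intro z
  let f' : ℂ →L[ℝ] ℂ := mfderiv 𝓘(ℝ, ℂ) 𝓘(ℝ, ℂ) m z
  refine (hasMFDerivAt_complex_of_real (f' := f') (mdifferentiableAt_diffeo z).hasMFDerivAt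
    (g' := ContinuousLinearMap.toSpanSingleton ℂ (f' 1)) ?_).mdifferentiableAt
  ext1 v
  have h1 : f' (v * 1) = v * f' 1 := hm z v (show ℂ from 1)
  rw [mul_one] at h1
  exact h1.symm

theorem IsComplexLinear.symm (hm : IsComplexLinear m) : IsComplexLinear m.symm := by
  intro z c v
  obtain ⟨z, rfl⟩ := m.surjective z
  obtain ⟨v, rfl⟩ := mfderiv_diffeo_surjective z v
  have h1 : ∀ w, tangentMap 𝓘(ℝ, ℂ) 𝓘(ℝ, ℂ) m.symm
      (⟨m z, mfderiv 𝓘(ℝ, ℂ) 𝓘(ℝ, ℂ) m z w⟩ : TangentBundle 𝓘(ℝ, ℂ) M) = ⟨z, w⟩ :=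
    fun w => tangentMap_symm_tangentMap (m := m) ⟨z, w⟩
  have h2 : ∀ w : ℂ, (mfderiv 𝓘(ℝ, ℂ) 𝓘(ℝ, ℂ) m.symm (m z)
      (mfderiv 𝓘(ℝ, ℂ) 𝓘(ℝ, ℂ) m z w) : ℂ) = w := fun w => by
    have h3 := h1 w
    have h4 : ∀ (y : M) (u : ℂ), (⟨y, u⟩ : TangentBundle 𝓘(ℝ, ℂ) M) = ⟨z, w⟩ → u = w := by
      intro y u h
      obtain ⟨rfl, h⟩ := Bundle.TotalSpace.mk.inj h
      exact eq_of_heq h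
    exact h4 _ _ h3
  rw [← hm z c v]
  exact (h2 _).trans (congrArg (c * ·) (h2 v).symm)

theorem dbarFun_comp (hm : IsComplexLinear m) {f : M → ℂ} {z : M}
    (hf : MDifferentiableAt 𝓘(ℝ, ℂ) 𝓘(ℝ, ℂ) f (m z)) (v : TangentSpace 𝓘(ℝ, ℂ) z) :
    dbarFun (fun y => f (m y)) z v = dbarFun f (m z) (mfderiv 𝓘(ℝ, ℂ) 𝓘(ℝ, ℂ) m z v) := by
  unfold dbarFun
  rw [mvfderiv_comp_map hf (mdifferentiableAt_diffeo z),
    mvfderiv_comp_map hf (mdifferentiableAt_diffeo z), hm]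

/-- The pullback of a holomorphic vector field under a holomorphic automorphism is holomorphic. -/
theorem IsHolVectorField.pullback [IsManifold 𝓘(ℂ, ℂ) ω M] (hm : IsComplexLinear m)
    {V V' : ∀ z : M, TangentSpace 𝓘(ℝ, ℂ) z} {U : Set M} (hV : IsHolVectorField V U)
    (hV' : ∀ z ∈ m ⁻¹' U, mfderiv 𝓘(ℝ, ℂ) 𝓘(ℝ, ℂ) m z (V' z) = V (m z)) :
    IsHolVectorField V' (m ⁻¹' U) := by
  have : IsManifold 𝓘(ℂ, ℂ) 1 M := .of_le (n := ω) le_top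
  have h1 : ContMDiff 𝓘(ℂ, ℂ) 𝓘(ℂ, ℂ) 2 m.symm := fun z =>
    contMDiffAt_of_eventually_mdifferentiableAt
      (Filter.Eventually.of_forall fun y => hm.symm.mdifferentiable y)
  have h2 := (h1.contMDiff_tangentMap (m := 1) (by norm_num)).mdifferentiable (by simp)
  have h3 := h2.comp_mdifferentiableOn
    (MDifferentiableOn.comp hV hm.mdifferentiable.mdifferentiableOn subset_rfl)
  refine h3.congr fun z hz => ?_
  have h4 := tangentMap_symm_tangentMap (m := m) ⟨z, V' z⟩
  have h5 : tangentMap 𝓘(ℝ, ℂ) 𝓘(ℝ, ℂ) m ⟨z, V' z⟩ = ⟨m z, V (m z)⟩ :=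
    congrArg (Bundle.TotalSpace.mk (m z)) (hV' z hz)
  rw [h5] at h4
  refine h4.symm.trans ?_
  exact congrArg (Bundle.TotalSpace.mk (m.symm (m z)))
    (mfderiv_real_eq_complex (hm.symm.mdifferentiable (m z)) (V (m z)))

end Automorphism

namespace SpinStructure

variable {M : Type*} [TopologicalSpace M] [ChartedSpace ℂ M] [IsManifold 𝓘(ℂ, ℂ) ω M]
  {h : SurfaceMetric M} {P : Type*} [TopologicalSpace P] [MulAction Circle P]
  {S : SpinStructure h P} {d : ℤ} {m : M ≃ₘ^∞⟮𝓘(ℝ, ℂ), 𝓘(ℝ, ℂ)⟯ M}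
  {Φ : ∀ z, S.L d z ≃ₗ[ℂ] S.L d (m z)}

/-- A diffeomorphism whose differential has a complex linear square root is holomorphic, because
every tangent vector is a square. -/
theorem IsSqrtDifferentialPow.isComplexLinear (hΦ : S.IsSqrtDifferentialPow d m Φ) :
    IsComplexLinear m := by
  obtain ⟨Ψ, -, hΨ, -⟩ := hΦ
  intro z c v
  obtain ⟨a, U, hz, ha⟩ := S.exists_holRoot z
  have ha0 : (show ℂ from S.sq (a z)) ≠ 0 := S.sq_ne_zero (ha.2.2.1 z hz)
  obtain ⟨w, hw⟩ := IsAlgClosed.exists_pow_nat_eq ((show ℂ from v) / (show ℂ from S.sq (a z)))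
    (n := 2) two_pos
  obtain ⟨u, rfl⟩ := IsAlgClosed.exists_pow_nat_eq c (n := 2) two_pos
  have hv : v = S.sq (w • a z) := by
    rw [S.sq_smul, hw]
    exact (div_mul_cancel₀ (show ℂ from v) ha0).symm
  rw [hv, ← S.sq_smul, ← hΨ, ← hΨ, map_smul, S.sq_smul]

theorem IsHolFrame.pullback (hΦ : S.IsSqrtDifferentialPow d m Φ) {e : ∀ z, S.L d z} {W : Set M}
    (he : S.IsHolFrame e W) : S.IsHolFrame (fun z => (Φ z).symm (e (m z))) (m ⁻¹' W) := by
  have hm := hΦ.isComplexLinear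
  obtain ⟨Ψ, hΨc, hΨ, hΦΨ⟩ := hΦ
  obtain ⟨a, ha, hea⟩ := he
  have h0 : ∀ z ∈ m ⁻¹' W, (Ψ z).symm (a (m z)) ≠ 0 := fun z hz =>
    (LinearEquiv.map_ne_zero_iff _).2 (ha.2.2.1 (m z) hz)
  refine ⟨fun z => (Ψ z).symm (a (m z)), ⟨ha.1.preimage m.continuous, hΨc a W ha.1 ha.2.1, h0,
    IsHolVectorField.pullback hm ha.2.2.2 fun z _ => ?_⟩, fun z hz => ?_⟩
  · rw [← hΨ, LinearEquiv.apply_symm_apply]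
  · rw [LinearEquiv.symm_apply_eq, hea (m z) hz, hΦΨ z _ (h0 z hz), LinearEquiv.apply_symm_apply]

theorem ratio_pullback {z : M} {b : S.L d (m z)} (hb : b ≠ 0) (a : S.L d (m z)) :
    S.ratio ((Φ z).symm b) ((Φ z).symm a) = S.ratio b a := by
  refine S.ratio_eq_of_eq_smul ((LinearEquiv.map_ne_zero_iff _).2 hb) ?_
  rw [← map_smul, S.ratio_smul_self hb]

theorem IsSmoothFrame.pullback (hΦ : S.IsSqrtDifferentialPow d m Φ) {θ : ∀ z, S.L d z}
    {U : Set M} (hθ : S.IsSmoothFrame θ U) :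
    S.IsSmoothFrame (fun z => (Φ z).symm (θ (m z))) (m ⁻¹' U) := by
  refine ⟨hθ.1.preimage m.continuous, fun z hz => ?_, fun z hz =>
    (LinearEquiv.map_ne_zero_iff _).2 (hθ.2.2 (m z) hz)⟩
  obtain ⟨e, W, hzW, he, hsm⟩ := hθ.2.1 (m z) hz
  refine ⟨_, m ⁻¹' W, hzW, he.pullback hΦ, ?_⟩
  refine (hsm.comp m.contMDiff.contMDiffOn fun y hy => hy).congr fun y hy => ?_
  exact ratio_pullback (he.ne_zero hy.2) _

theorem dbarL_pullback (hΦ : S.IsSqrtDifferentialPow d m Φ) {θ : ∀ z, S.L d z}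
    {U : Set M} (hθ : S.IsSmoothFrame θ U) {z : M} (hz : m z ∈ U) (v : TangentSpace 𝓘(ℝ, ℂ) z) :
    S.dbarL (fun y => (Φ y).symm (θ (m y))) z v
      = (Φ z).symm (S.dbarL θ (m z) (mfderiv 𝓘(ℝ, ℂ) 𝓘(ℝ, ℂ) m z v)) := by
  obtain ⟨e, W, hzW, he⟩ := S.exists_holFrame d (m z)
  have h1 := hθ.mdifferentiableAt_ratio he.isSmoothFrame hz hzW
  have h2 := (hθ.pullback hΦ).mdifferentiableAt_ratio (he.pullback hΦ).isSmoothFrame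
    (z := z) hz hzW
  have h3 : (fun y => S.ratio ((Φ y).symm (e (m y))) ((Φ y).symm (θ (m y)))) =ᶠ[𝓝 z]
      fun y => S.ratio (e (m y)) (θ (m y)) := by
    filter_upwards [(he.isOpen.preimage m.continuous).mem_nhds hzW] with y hy
    exact ratio_pullback (he.ne_zero hy) _
  rw [dbarL_eq he hzW h1, dbarL_eq (he.pullback hΦ) hzW h2, dbarFun_congr h3, map_smul,
    dbarFun_comp hΦ.isComplexLinear (f := fun w => S.ratio (e w) (θ w)) h1]

end SpinStructure

/-! ### The operator `D^{A,J}` -/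

section Operator

variable {M : Type*} [TopologicalSpace M] [ChartedSpace ℂ M] [IsManifold 𝓘(ℂ, ℂ) ω M]
  {E : Type*} [NormedAddCommGroup E] [NormedSpace ℝ E]
  {X : Type*} [TopologicalSpace X] [ChartedSpace E X] [IsManifold 𝓘(ℝ, E) ∞ X]
  {h : SurfaceMetric M} {P : Type*} [TopologicalSpace P] [MulAction Circle P]
  {S : SpinStructure h P} {d : ℤ} {J : AlmostComplexStructure E X} {φ : M → X}
  {θ θ' : ∀ z, S.L d z} {ψ : ∀ z, TwistedFib S d J φ z}

theorem smul_toC (x : X) (c : ℂ) (v : TangentSpace 𝓘(ℝ, E) x) :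
    c • toC J x v = toC J x (complexSMul J x c v) := rfl

theorem toC_add (x : X) (v w : TangentSpace 𝓘(ℝ, E) x) :
    toC J x (v + w) = toC J x v + toC J x w := rfl

/-- The component with respect to `b` of an element of `L_d ⊗_J φ^* TX`. -/
def fibComponent {z : M} (b : S.L d z) (t : TwistedFib S d J φ z) : TangentSpace 𝓘(ℝ, E) (φ z) :=
  ofC J (φ z) (TensorProduct.lid ℂ (CTangent J (φ z))
    (LinearMap.rTensor (CTangent J (φ z)) (S.ratio b) t))

theorem component_eq (z : M) : component S θ ψ z = fibComponent (θ z) (ψ z) := rfl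

theorem fibComponent_add {z : M} (b : S.L d z) (t t' : TwistedFib S d J φ z) :
    fibComponent b (t + t') = fibComponent b t + fibComponent b t' := by
  unfold fibComponent
  rw [map_add, map_add]
  rfl

theorem fibComponent_tmul {z : M} (b a : S.L d z) (w : TangentSpace 𝓘(ℝ, E) (φ z)) :
    fibComponent b (a ⊗ₜ[ℂ] toC J (φ z) w) = complexSMul J (φ z) (S.ratio b a) w := rfl

theorem tmul_fibComponent {z : M} {b : S.L d z} (hb : b ≠ 0) (t : TwistedFib S d J φ z) :
    b ⊗ₜ[ℂ] toC J (φ z) (fibComponent b t) = t := by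
  induction t using TensorProduct.induction_on with
  | zero =>
    have h1 : fibComponent b (0 : TwistedFib S d J φ z) = 0 := by
      unfold fibComponent
      rw [map_zero, map_zero]
      rfl
    rw [h1]
    exact TensorProduct.tmul_zero _ _
  | tmul a w =>
    have h1 := fibComponent_tmul (J := J) (φ := φ) b a (ofC J (φ z) w)
    change b ⊗ₜ[ℂ] toC J (φ z) (fibComponent b (a ⊗ₜ[ℂ] toC J (φ z) (ofC J (φ z) w))) = _
    rw [h1, ← smul_toC, ← TensorProduct.smul_tmul, S.ratio_smul_self hb]
    rfl
  | add t t' ht ht' => rw [fibComponent_add, toC_add, TensorProduct.tmul_add, ht, ht']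

theorem fibComponent_change {z : M} {a b : S.L d z} (ha : a ≠ 0) (t : TwistedFib S d J φ z) :
    fibComponent b t = complexSMul J (φ z) (S.ratio b a) (fibComponent a t) := by
  conv_lhs => rw [← tmul_fibComponent ha t]
  rfl

/-- A section is smooth if it is smooth with respect to one smooth frame near every point. -/
theorem isSmoothTwisted_of_locally {U : Set M}
    (H : ∀ z ∈ U, ∃ (θ : ∀ z, S.L d z) (W : Set M), z ∈ W ∧ S.IsSmoothFrame θ W ∧
      IsSmoothAlong φ (component S θ ψ) (U ∩ W)) : IsSmoothTwisted S ψ U := by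
  intro θ' W' hθ'
  refine isSmoothAlong_of_locally fun z hz => ?_
  obtain ⟨θ, W, hzW, hθ, hsm⟩ := H z hz.1
  refine ⟨W, hθ.1, hzW, ?_⟩
  have h1 : IsSmoothAlong φ (component S θ ψ) (U ∩ W' ∩ W) :=
    hsm.mono fun y hy => ⟨hy.1.1, hy.2⟩
  refine (h1.complexSMul J ((hθ.contMDiffOn_ratio hθ').mono
    fun y hy => ⟨hy.2, hy.1.2⟩)).congr fun y hy => ?_
  exact fibComponent_change (hθ.2.2 y hy.2) _

variable [T2Space X] [FiniteDimensional ℝ E]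
  (A : CovariantDerivative 𝓘(ℝ, E) E (fun x : X => TangentSpace 𝓘(ℝ, E) x))

/-- The operator `D^{A,J}` can be computed with an arbitrary smooth frame of `L_d`. -/
theorem superD_eq (hφ : ContMDiff 𝓘(ℝ, ℂ) 𝓘(ℝ, E) ∞ φ) (hψ : IsSmoothTwisted S ψ Set.univ)
    {U : Set M} (hθ : S.IsSmoothFrame θ U) {z : M} (hz : z ∈ U) (v : TangentSpace 𝓘(ℝ, ℂ) z) :
    superD S A ψ z v = θ z ⊗ₜ[ℂ] toC J (φ z) (pullbackCov01 A J φ (component S θ ψ) z v)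
      + S.dbarL θ z v ⊗ₜ[ℂ] toC J (φ z) (component S θ ψ z) := by
  obtain ⟨U₀, hz₀, hθ₀⟩ : ∃ U₀ : Set M, z ∈ U₀ ∧ S.IsSmoothFrame (S.smoothFrameAt d z) U₀ :=
    (S.exists_smoothFrame d z).choose_spec
  have hcomp : IsSmoothAlong φ (component S (S.smoothFrameAt d z) ψ) U₀ := by
    simpa only [Set.univ_inter] using hψ _ _ hθ₀
  have hg := hθ₀.mdifferentiableAt_ratio hθ hz₀ hz
  have h1 : ∀ᶠ y in 𝓝 z, component S θ ψ y = complexSMul J (φ y)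
      (S.ratio (θ y) (S.smoothFrameAt d z y)) (component S (S.smoothFrameAt d z) ψ y) := by
    filter_upwards [hθ₀.1.mem_nhds hz₀] with y hy
    exact fibComponent_change (hθ₀.2.2 y hy) _
  have h2 := pullbackCov01_complexSMul A J hφ hθ₀.1 hcomp hz₀ hg h1 v
  have h3 := SpinStructure.dbarL_eq_ratio hθ hθ₀ hz hz₀ v
  rw [h2, h1.self_of_nhds]
  unfold superD
  simp only []
  rw [h3, toC_add, ← smul_toC, ← smul_toC, ← smul_toC, TensorProduct.tmul_add,
    ← TensorProduct.smul_tmul, ← TensorProduct.smul_tmul, ← TensorProduct.smul_tmul,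
    S.ratio_smul_self (hθ.2.2 z hz), TensorProduct.add_tmul]
  abel

/-- The operator `D^{A,J}` maps smooth sections to smooth `(0,1)`-forms. -/
theorem isZeroOneForm_superD [CovariantDerivative.ContMDiffCovariantDerivative A ∞]
    (hφ : ContMDiff 𝓘(ℝ, ℂ) 𝓘(ℝ, E) ∞ φ) (hψ : IsSmoothTwisted S ψ Set.univ) :
    IsZeroOneForm S (superD S A ψ) := by
  refine ⟨fun z v w => ?_, fun z c v => ?_, fun V U hU hV => ?_⟩
  · unfold superD SpinStructure.dbarL
    simp only [pullbackCov01_add, dbarFun_add, toC_add, TensorProduct.tmul_add, add_smul,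
      TensorProduct.add_tmul]
    abel
  · unfold superD SpinStructure.dbarL
    simp only [pullbackCov01_cmul, dbarFun_cmul, ← smul_toC, TensorProduct.tmul_smul, mul_smul,
      ← TensorProduct.smul_tmul', smul_add]
  · refine isSmoothTwisted_of_locally fun z hz => ?_
    obtain ⟨e, W, hzW, he⟩ := S.exists_holFrame d z
    refine ⟨e, W, hzW, he.isSmoothFrame, ?_⟩
    have hUW : IsOpen (U ∩ W) := hU.inter he.isOpen
    have hV' := hV.mono (s := U) (t := U ∩ W) Set.inter_subset_left
    have hcomp : IsSmoothAlong φ (component S e ψ) (U ∩ W) := by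
      have h1 := hψ _ _ he.isSmoothFrame
      exact h1.mono fun y hy => ⟨trivial, hy.2⟩
    have h1 := isSmoothAlong_pullbackCov A J hφ hUW hcomp hV'
    have h2 := isSmoothAlong_pullbackCov A J hφ hUW hcomp (contMDiffOn_cmul Complex.I hV')
    have h3 : IsSmoothAlong φ (fun y => pullbackCov01 A J φ (component S e ψ) y (V y)) (U ∩ W) :=
      (h1.add (h2.comp_J J)).smul (f := fun _ => 1 / 2) contMDiffOn_const
    refine h3.congr fun y hy => ?_
    have he0 := he.ne_zero hy.2
    -- a holomorphic frame is annihilated by the Dolbeault operator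
    have h4 : S.dbarL e y (V y) = 0 := by
      have h5 := he.mdifferentiableAt_ratio he hy.2 hy.2
      rw [SpinStructure.dbarL_eq he hy.2 (mdifferentiableAt_real_of_complex h5),
        dbarFun_eq_zero h5, zero_smul]
    rw [component_eq, superD_eq A hφ hψ he.isSmoothFrame hy.2, h4, TensorProduct.zero_tmul,
      add_zero, fibComponent_tmul, S.ratio_self he0]
    simp [complexSMul]

end Operator

/-! ### The transformation law -/

section Transformation

section CauchyRiemann

variable {M : Type*} [TopologicalSpace M] [ChartedSpace ℂ M]
  {E : Type*} [NormedAddCommGroup E] [NormedSpace ℝ E]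
  {X : Type*} [TopologicalSpace X] [ChartedSpace E X] [IsManifold 𝓘(ℝ, E) ∞ X]
  {J : AlmostComplexStructure E X} {φ : M → X} {m : M ≃ₘ^∞⟮𝓘(ℝ, ℂ), 𝓘(ℝ, ℂ)⟯ M}

/-- The operator `∂̄_J` is natural with respect to holomorphic automorphisms of the source. -/
theorem dbarJ_comp (hm : IsComplexLinear m) (hφ : ContMDiff 𝓘(ℝ, ℂ) 𝓘(ℝ, E) ∞ φ) (z : M)
    (v : TangentSpace 𝓘(ℝ, ℂ) z) :
    dbarJ J (φ ∘ m) z v = dbarJ J φ (m z) (mfderiv 𝓘(ℝ, ℂ) 𝓘(ℝ, ℂ) m z v) := by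
  have h1 : ∀ w, mfderiv 𝓘(ℝ, ℂ) 𝓘(ℝ, E) (φ ∘ m) z w
      = mfderiv 𝓘(ℝ, ℂ) 𝓘(ℝ, E) φ (m z) (mfderiv 𝓘(ℝ, ℂ) 𝓘(ℝ, ℂ) m z w) := fun w =>
    mfderiv_comp_apply z ((hφ (m z)).mdifferentiableAt (by simp)) (mdifferentiableAt_diffeo z) w
  unfold dbarJ
  rw [h1, h1, hm]
  rfl

end CauchyRiemann

variable {M : Type*} [TopologicalSpace M] [ChartedSpace ℂ M] [IsManifold 𝓘(ℂ, ℂ) ω M]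
  {E : Type*} [NormedAddCommGroup E] [NormedSpace ℝ E]
  {X : Type*} [TopologicalSpace X] [ChartedSpace E X] [IsManifold 𝓘(ℝ, E) ∞ X]
  {h : SurfaceMetric M} {P : Type*} [TopologicalSpace P] [MulAction Circle P]
  {S : SpinStructure h P} {d : ℤ} {J : AlmostComplexStructure E X} {φ : M → X}
  {ψ : ∀ z, TwistedFib S d J φ z} {m : M ≃ₘ^∞⟮𝓘(ℝ, ℂ), 𝓘(ℝ, ℂ)⟯ M}
  {Φ : ∀ z, S.L d z ≃ₗ[ℂ] S.L d (m z)}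

theorem liftInv_tmul (z : M) (a : S.L d (m z)) (w : TangentSpace 𝓘(ℝ, E) (φ (m z))) :
    liftInv S Φ z (a ⊗ₜ[ℂ] toC J (φ (m z)) w : TwistedFib S d J φ (m z))
      = (Φ z).symm a ⊗ₜ[ℂ] toC J ((φ ∘ m) z) w := rfl

theorem liftInv_injective (z : M) :
    Function.Injective (liftInv (J := J) (φ := φ) S Φ z) := by
  have h1 := (TensorProduct.congr (Φ z).symm (LinearEquiv.refl ℂ (CTangent J (φ (m z))))).injective
  intro t t' ht
  exact h1 ht

/-- The components of the transformed section with respect to the pulled back frame. -/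
theorem component_transform {θ : ∀ z, S.L d z} {z : M} (hz : θ (m z) ≠ 0) :
    component S (fun y => (Φ y).symm (θ (m y))) (transform S Φ ψ) z = component S θ ψ (m z) := by
  have h1 := tmul_fibComponent (J := J) (φ := φ) hz (ψ (m z))
  rw [component_eq, transform, ← h1, liftInv_tmul, fibComponent_tmul,
    S.ratio_self ((LinearEquiv.map_ne_zero_iff _).2 hz)]
  simp [complexSMul, component_eq]

theorem isSmoothTwisted_transform (hΦ : S.IsSqrtDifferentialPow d m Φ)
    (hψ : IsSmoothTwisted S ψ Set.univ) : IsSmoothTwisted S (transform S Φ ψ) Set.univ := by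
  refine isSmoothTwisted_of_locally fun z _ => ?_
  obtain ⟨θ, W, hzW, hθ⟩ := S.exists_smoothFrame d (m z)
  refine ⟨_, m ⁻¹' W, hzW, hθ.pullback hΦ, ?_⟩
  have h1 : IsSmoothAlong (φ ∘ m) (fun y => component S θ ψ (m y)) (Set.univ ∩ m ⁻¹' W) :=
    ContMDiffOn.comp (hψ θ W hθ) m.contMDiff.contMDiffOn fun y hy => hy
  exact h1.congr fun y hy => component_transform (hθ.2.2 _ hy.2)

/-- The transformation law of `D^{A,J}`: both sides are computed with a frame of `L_d` near `m z` and
its pullback under the lift `Φ`. -/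
theorem superD_transform [T2Space X] [FiniteDimensional ℝ E]
    (A : CovariantDerivative 𝓘(ℝ, E) E (fun x : X => TangentSpace 𝓘(ℝ, E) x))
    (hΦ : S.IsSqrtDifferentialPow d m Φ) (hφ : ContMDiff 𝓘(ℝ, ℂ) 𝓘(ℝ, E) ∞ φ)
    (hψ : IsSmoothTwisted S ψ Set.univ) (z : M) (v : TangentSpace 𝓘(ℝ, ℂ) z) :
    superD S A (transform S Φ ψ) z v
      = liftInv S Φ z (superD S A ψ (m z) (mfderiv 𝓘(ℝ, ℂ) 𝓘(ℝ, ℂ) m z v)) := by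
  obtain ⟨θ, W, hzW, hθ⟩ := S.exists_smoothFrame d (m z)
  have hm := hΦ.isComplexLinear
  have hcomp : IsSmoothAlong φ (component S θ ψ) W := by
    simpa only [Set.univ_inter] using hψ θ W hθ
  have hcont := (hθ.1.preimage m.continuous).mem_nhds hzW
  -- the covariant derivative only depends on the germ of the component
  have h1 : ∀ w : TangentSpace 𝓘(ℝ, ℂ) z, pullbackCov A J (φ ∘ m)
      (component S (fun y => (Φ y).symm (θ (m y))) (transform S Φ ψ)) z w
        = pullbackCov A J φ (component S θ ψ) (m z) (mfderiv 𝓘(ℝ, ℂ) 𝓘(ℝ, ℂ) m z w) := by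
    intro w
    rw [← pullbackCov_comp A J (mdifferentiableAt_diffeo z) hθ.1 hzW hcomp w]
    unfold pullbackCov
    have h2 : (fun y => (trivializationAt E (TangentSpace 𝓘(ℝ, E)) ((φ ∘ m) z) ⟨(φ ∘ m) y,
        component S (fun y => (Φ y).symm (θ (m y))) (transform S Φ ψ) y⟩).2) =ᶠ[𝓝 z]
      fun y => (trivializationAt E (TangentSpace 𝓘(ℝ, E)) ((φ ∘ m) z) ⟨(φ ∘ m) y,
        component S θ ψ (m y)⟩).2 := by
      filter_upwards [hcont] with y hy
      rw [component_transform (hθ.2.2 _ hy)]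
    rw [mvfderiv_congr h2, component_transform (hθ.2.2 _ hzW)]
  have h2 : pullbackCov01 A J (φ ∘ m)
      (component S (fun y => (Φ y).symm (θ (m y))) (transform S Φ ψ)) z v
        = pullbackCov01 A J φ (component S θ ψ) (m z) (mfderiv 𝓘(ℝ, ℂ) 𝓘(ℝ, ℂ) m z v) := by
    unfold pullbackCov01
    rw [h1, h1, hm]
    rfl
  rw [superD_eq A (hφ.comp m.contMDiff) (isSmoothTwisted_transform hΦ hψ) (hθ.pullback hΦ)
      (z := z) hzW, superD_eq A hφ hψ hθ hzW, map_add, liftInv_tmul, liftInv_tmul, h2,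
    SpinStructure.dbarL_pullback hΦ hθ hzW, component_transform (hθ.2.2 _ hzW)]

end Transformation

end Supercurve

end

theorem mainTheorem10
    {M : Type*} [TopologicalSpace M] [T2Space M] [CompactSpace M] [ConnectedSpace M]
    [ChartedSpace ℂ M] [IsManifold 𝓘(ℂ, ℂ) ω M]
    (h : Supercurve.SurfaceMetric M) (hh : Supercurve.InConformalClass h)
    {P : Type*} [TopologicalSpace P] [MulAction Circle P]
    (S : Supercurve.SpinStructure h P) (d : ℤ) (hd : d ≠ 0)
    {E : Type*} [NormedAddCommGroup E] [NormedSpace ℝ E] [FiniteDimensional ℝ E]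
    {X : Type*} [TopologicalSpace X] [T2Space X] [ChartedSpace E X] [IsManifold 𝓘(ℝ, E) ∞ X]
    (J : Supercurve.AlmostComplexStructure E X)
    (A : CovariantDerivative 𝓘(ℝ, E) E (fun x : X => TangentSpace 𝓘(ℝ, E) x))
    [CovariantDerivative.ContMDiffCovariantDerivative A ∞]
    (m : M ≃ₘ^∞⟮𝓘(ℝ, ℂ), 𝓘(ℝ, ℂ)⟯ M) (hm : Supercurve.IsConformalAut h m)
    (hid : ContinuousMap.Homotopic (⟨m, m.continuous⟩ : C(M, M)) (ContinuousMap.id M))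
    (Φ : ∀ z, S.L d z ≃ₗ[ℂ] S.L d (m z)) (hΦ : S.IsSqrtDifferentialPow d m Φ)
    (φ : M → X) (hφ : ContMDiff 𝓘(ℝ, ℂ) 𝓘(ℝ, E) ∞ φ)
    (ψ : ∀ z, Supercurve.TwistedFib S d J φ z)
    (hψ : Supercurve.IsSmoothTwisted S ψ Set.univ) :
    -- the transformed section is again smooth
    Supercurve.IsSmoothTwisted S (Supercurve.transform S Φ ψ) Set.univ ∧
    -- transformation of the operator, as an identity of smooth `(0,1)`-forms
    Supercurve.IsZeroOneForm S (Supercurve.superD S A (Supercurve.transform S Φ ψ)) ∧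
    (∀ (z : M) (v : TangentSpace 𝓘(ℝ, ℂ) z),
      Supercurve.superD S A (Supercurve.transform S Φ ψ) z v =
        Supercurve.liftInv S Φ z
          (Supercurve.superD S A ψ (m z) (mfderiv 𝓘(ℝ, ℂ) 𝓘(ℝ, ℂ) m z v))) ∧
    -- invariance of the defining equations
    ((∀ z v, Supercurve.dbarJ J φ z v = 0) ↔ ∀ z v, Supercurve.dbarJ J (φ ∘ m) z v = 0) ∧
    ((∀ z v, Supercurve.superD S A ψ z v = 0) ↔
      ∀ z v, Supercurve.superD S A (Supercurve.transform S Φ ψ) z v = 0) := by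
  have hlin := hΦ.isComplexLinear
  have key := Supercurve.superD_transform A hΦ hφ hψ
  refine ⟨Supercurve.isSmoothTwisted_transform hΦ hψ,
    Supercurve.isZeroOneForm_superD A (hφ.comp m.contMDiff)
      (Supercurve.isSmoothTwisted_transform hΦ hψ), key, ⟨fun H z v => ?_, fun H z v => ?_⟩,
    ⟨fun H z v => ?_, fun H z v => ?_⟩⟩
  · rw [Supercurve.dbarJ_comp hlin hφ]
    exact H _ _
  · obtain ⟨z, rfl⟩ : ∃ y, m y = z := m.surjective z
    obtain ⟨v, rfl⟩ := Supercurve.mfderiv_diffeo_surjective z v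
    rw [← Supercurve.dbarJ_comp hlin hφ]
    exact H _ _
  · rw [key, H, map_zero]
  · obtain ⟨z, rfl⟩ : ∃ y, m y = z := m.surjective z
    obtain ⟨v, rfl⟩ := Supercurve.mfderiv_diffeo_surjective z v
    refine Supercurve.liftInv_injective (Φ := Φ) z ?_
    rw [← key, H, map_zero]
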